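/- Let $k$ be a field, let $d\ge 2$, and let $\Delta$ be a simplicial complex on a finite vertex set $V$ all of whose facets (maximal faces) have exactly $d$ vertices, i.e. $\Delta$ is pure of dimension $d-1$. Two facets $F,G$ of a complex are connected if there is a chain of facets $F=F_0,F_1,\dots,F_m=G$ with $F_j\cap F_{j+1}\neq\emptyset$ for all $j$; the complex is connected if any two of its facets are connected. A facet $F$ is a leaf if it is the only facet, or if there is a facet $G\ne F$ with $F\cap F'\subseteq F\cap G$ for every facet $F'\neq F$. A subcomplex means a complex whose facet set is a subset of the facet set. A complex is a tree if it is connected and each of its nonempty connected subcomplexes has a leaf, and a forest if each of its connected components is a tree. Assume that $\Delta$ is a forest. Let $R=k[x : x\in V]$ with the standard grading, let $\mathcal F(\Delta)$ be the set of facets of $\Delta$, and let $$\mathcal I(\Delta)=\Big(\prod_{x\in F}x \;:\; F\in\mathcal F(\Delta)\Big)\subseteq R$$ be the facet ideal. Let $\mathcal A(\Delta)$ be the set of faces of $\Delta$ with $d-1$ vertices, and for $G\in\mathcal A(\Delta)$ let $\deg_\Delta(G)$ be the number of facets of $\Delta$ containing $G$. Then $\mathcal I(\Delta)$ has a minimal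 graded free resolution over $R$, and its graded Betti numbers $\beta_{i,j}$ (the number of generators of degree $j$ of the $i$-th free module in any minimal graded free resolution of $\mathcal I(\Delta)$) satisfy $$\beta_{0,d}(\mathcal I(\Delta))=|\mathcal F(\Delta)|,\qquad \beta_{i,i+d}(\mathcal I(\Delta))=\sum_{G\in\mathcal A(\Delta)}\binom{\deg_\Delta(G)}{i+1}\quad\text{for all } i\ge 1.$$ -/

import Mathlib

/-! ### Simplicial complexes through their facets

A simplicial complex is `AbstractSimplicialComplex V`: all singletons are faces, and the empty
face, which plays no role here, is left implicit. A complex is determined by its set of facets,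
and a subcomplex is given by a subset of that set, so that connectedness, leaves, trees and
forests are defined for families `S : Set (Finset V)` of facets. -/

namespace FacetFamily

variable {V : Type*} [DecidableEq V]

/-- `F` and `G` are joined by a chain `F = F₀, F₁, …, Fₘ = G` of members of `S` with
`Fᵢ ∩ Fᵢ₊₁ ≠ ∅`. (It is only used for `F, G ∈ S`.) -/
def Linked (S : Set (Finset V)) : Finset V → Finset V → Prop :=
  Relation.ReflTransGen fun A B => A ∈ S ∧ B ∈ S ∧ (A ∩ B).Nonempty

/-- The complex with facet set `S` is connected: any two facets are connected by a chain. -/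
def IsConnected (S : Set (Finset V)) : Prop :=
  ∀ F ∈ S, ∀ G ∈ S, Linked S F G

/-- `F` is a leaf of the complex with facet set `S`: it is the only facet, or there is a facet
`G ≠ F` such that `F ∩ F' ⊆ F ∩ G` for every facet `F' ≠ F`. -/
def IsLeaf (S : Set (Finset V)) (F : Finset V) : Prop :=
  F ∈ S ∧ (S = {F} ∨ ∃ G ∈ S, G ≠ F ∧ ∀ F' ∈ S, F' ≠ F → F ∩ F' ⊆ F ∩ G)

/-- The complex with facet set `S` is a tree: it is connected and every nonempty connected
subcomplex has a leaf. -/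
def IsTree (S : Set (Finset V)) : Prop :=
  IsConnected S ∧ ∀ T ⊆ S, T.Nonempty → IsConnected T → ∃ F, IsLeaf T F

/-- The facets of the connected component containing the facet `F`. -/
def component (S : Set (Finset V)) (F : Finset V) : Set (Finset V) :=
  {G | G ∈ S ∧ Linked S F G}

/-- The complex with facet set `S` is a forest: every connected component is a tree. -/
def IsForest (S : Set (Finset V)) : Prop :=
  ∀ F ∈ S, IsTree (component S F)

end FacetFamily

namespace AbstractSimplicialComplex

variable {V : Type*}

/-- The facets: the faces that are maximal under inclusion. -/
def facets (Δ : AbstractSimplicialComplex V) : Set (Finset V) :=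
  {F | F ∈ Δ.faces ∧ ∀ G ∈ Δ.faces, F ⊆ G → F = G}

/-- `Δ` is a simplicial forest. -/
def IsForest [DecidableEq V] (Δ : AbstractSimplicialComplex V) : Prop :=
  FacetFamily.IsForest Δ.facets

/-- All facets of `Δ` have exactly `d` vertices, i.e. `Δ` is pure of dimension `d - 1`. -/
def IsPureOfCard (Δ : AbstractSimplicialComplex V) (d : ℕ) : Prop :=
  ∀ F ∈ Δ.facets, F.card = d

/-- The number of facets of `Δ` that contain `G`. -/
noncomputable def facetDegree (Δ : AbstractSimplicialComplex V) (G : Finset V) : ℕ :=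
  {F | F ∈ Δ.facets ∧ G ⊆ F}.ncard

open Classical in
/-- The faces of `Δ` with exactly `m` vertices, i.e. of dimension `m - 1` (for `m ≥ 1`). -/
noncomputable def facesOfCard [Fintype V] (Δ : AbstractSimplicialComplex V) (m : ℕ) :
    Finset (Finset V) :=
  Finset.univ.filter fun G => G ∈ Δ.faces ∧ G.card = m

/-- The facet ideal of `Δ` in the polynomial ring whose variables are the vertices: it is
generated by the squarefree monomials `∏ x ∈ F, x` of the facets `F`. -/
noncomputable def facetIdeal (k : Type*) [Field k] (Δ : AbstractSimplicialComplex V) :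
    Ideal (MvPolynomial V k) :=
  Ideal.span {p | ∃ F ∈ Δ.facets, p = ∏ x ∈ F, MvPolynomial.X x}

end AbstractSimplicialComplex

/-! ### Minimal graded free resolutions and graded Betti numbers -/

/-- A minimal graded free resolution `⋯ → F₁ → F₀ → I → 0` of an ideal `I` of a polynomial ring
`R` with the standard grading, with `Fᵢ = ⨁_b R(-deg i b)`, `b` running over `rank i` basis
elements. -/
structure MinimalGradedFreeResolution {V k : Type*} [Field k] (I : Ideal (MvPolynomial V k)) where
  /-- the rank of `Fᵢ` -/
  rank : ℕ → ℕ
  /-- the degrees of the basis elements of `Fᵢ` -/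
  deg : (i : ℕ) → Fin (rank i) → ℕ
  /-- the differential `Fᵢ₊₁ → Fᵢ` -/
  diff : (i : ℕ) → (Fin (rank (i + 1)) → MvPolynomial V k) →ₗ[MvPolynomial V k]
    (Fin (rank i) → MvPolynomial V k)
  /-- the augmentation `F₀ → I` -/
  aug : (Fin (rank 0) → MvPolynomial V k) →ₗ[MvPolynomial V k] I
  aug_surjective : Function.Surjective aug
  exact_zero : Function.Exact (diff 0) aug
  exact_succ : ∀ i, Function.Exact (diff (i + 1)) (diff i)
  /-- The augmentation preserves degrees. -/
  aug_homogeneous : ∀ b,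
    ((aug (Pi.single b 1) : I) : MvPolynomial V k).IsHomogeneous (deg 0 b)
  /-- The differentials preserve degrees: the matrix entry from the basis element `c` of `Fᵢ₊₁` to
  the basis element `b` of `Fᵢ` is homogeneous of degree `deg c - deg b` (hence zero if that is
  negative). -/
  diff_homogeneous : ∀ i c b, ∀ m ∈ (diff i (Pi.single c 1) b).support,
    m.degree + deg i b = deg (i + 1) c
  /-- Minimality: the image of `Fᵢ₊₁` lies in `𝔪 Fᵢ`, where `𝔪` is the ideal generated by the
  variables. -/
  minimal : ∀ i v b, diff i v b ∈ Ideal.span (Set.range (MvPolynomial.X : V → MvPolynomial V k))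

/-- The graded Betti number `β_{i,j}` read off from a minimal graded free resolution: the number of
basis elements of `Fᵢ` of degree `j`, i.e. the multiplicity of `R(-j)` in `Fᵢ`. -/
def MinimalGradedFreeResolution.betti {V k : Type*} [Field k] {I : Ideal (MvPolynomial V k)}
    (P : MinimalGradedFreeResolution I) (i j : ℕ) : ℕ :=
  (Finset.univ.filter fun b : Fin (P.rank i) => P.deg i b = j).card

/-! The Betti number `β_{i,i+d}` is the dimension of `Torᵢ(I, k)` in degree `i + d`. Since the facet
ideal `I` vanishes in degrees below `d`, the Koszul complex computes this as a space of cycles: the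
alternating families `z(a₁, …, aᵢ)` of forms of degree `d` in `I` with `∑ₐ xₐ z(…, a) = 0`. No `Tor`
is needed for the comparison: in a minimal resolution, an element `v` of degree `i + d` of `Fᵢ` is a
constant vector, its differential is `∑ₐ xₐ vₐ` with `vₐ ∈ Fᵢ₋₁` of the same kind, and iterating
`v ↦ (vₐ)ₐ` gives a bijection with these families
(`MinimalGradedFreeResolution.isStrand_iff`, `MinimalGradedFreeResolution.strandMap_injOn`).
A minimal resolution exists because a minimal system of homogeneous generators of a graded
submodule has its relations in `𝔪 F` (`exists_minimal_cover`).

It remains to find the cycles for `i ≥ 1`. Suppose that the monomial of a facet `F` occurs in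
`z(α)`. In the cycle condition in position `j`, its multiple by the variable `α j` must cancel, so
that `α j ∉ F` and `F ∖ b ∪ α j` is a facet for some `b ∈ F` (`IsStrand.exists_exchange`). In a
forest, `b` is the same for all `j`; otherwise four facets would form a subfamily without a leaf
(`FacetFamily.IsForest.erase_unique_of_exchange`). Hence the members of `α` and `b` all complete
the face `G = F ∖ b` to facets, and the cycle is determined by alternating functions of `i + 1`
vertices completing such faces `G`. Conversely, each alternating function of this kind gives a cycle
(`isStrand_of_alternating`), and different `G` do not interfere, since a set with `d + 1` elements
contains at most two facets (`FacetFamily.IsForest.erase_unique`). This leaves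
`∑_G (deg G choose i + 1)` dimensions. -/

/-! ### Homogeneous vectors and graded parts -/

section GradedParts

open MvPolynomial

variable {V k : Type*} [Field k]

/-- The part of `p` of degree `e - t`, which is `0` if `e < t`: this is the part of degree `e` of
`p` as an element of the shifted module `R(-t)`. -/
noncomputable def shiftPart (t e : ℕ) (p : MvPolynomial V k) : MvPolynomial V k :=
  if t ≤ e then homogeneousComponent (e - t) p else 0

theorem coeff_shiftPart (t e : ℕ) (p : MvPolynomial V k) (m : V →₀ ℕ) :
    coeff m (shiftPart t e p) = if m.degree + t = e then coeff m p else 0 := by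
  unfold shiftPart
  split_ifs with h1 h2 h2
  · rw [coeff_homogeneousComponent, if_pos (by omega)]
  · rw [coeff_homogeneousComponent, if_neg (by omega)]
  · omega
  · simp

theorem shiftPart_mul {s t : ℕ} {q : MvPolynomial V k}
    (hq : ∀ m ∈ q.support, m.degree + t = s) (e : ℕ) (p : MvPolynomial V k) :
    shiftPart t e (p * q) = shiftPart s e p * q := by
  classical
  ext m
  simp only [coeff_shiftPart, coeff_mul, ite_mul, zero_mul]
  have hsum : ∀ (c : Prop) [Decidable c] (g : (V →₀ ℕ) × (V →₀ ℕ) → k),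
      (if c then ∑ x ∈ Finset.HasAntidiagonal.antidiagonal m, g x else 0) =
        ∑ x ∈ Finset.HasAntidiagonal.antidiagonal m, if c then g x else 0 := by
    intro c _ g
    split_ifs <;> simp
  rw [hsum]
  refine Finset.sum_congr rfl fun x hx => ?_
  by_cases h : coeff x.2 q = 0
  · simp [h]
  · have h1 := hq x.2 (by simpa [mem_support_iff] using h)
    have h2 : x.1.degree + x.2.degree = m.degree := by
      rw [← map_add, Finset.HasAntidiagonal.mem_antidiagonal.1 hx]
    have : m.degree + t = e ↔ x.1.degree + s = e := by omega
    simp [this]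

theorem shiftPart_sum {ι : Type*} (t e : ℕ) (s : Finset ι) (p : ι → MvPolynomial V k) :
    shiftPart t e (∑ i ∈ s, p i) = ∑ i ∈ s, shiftPart t e (p i) := by
  unfold shiftPart
  split_ifs <;> simp

/-- `v` is homogeneous of degree `e` in the graded free module `⨁_b R(-δ b)`. -/
def IsHomog {ι : Type*} (δ : ι → ℕ) (e : ℕ) (v : ι → MvPolynomial V k) : Prop :=
  ∀ b, ∀ m ∈ (v b).support, m.degree + δ b = e

theorem isHomog_shiftPart {ι : Type*} (δ : ι → ℕ) (e : ℕ) (v : ι → MvPolynomial V k) :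
    IsHomog δ e fun b => shiftPart (δ b) e (v b) := by
  intro b m hm
  rw [mem_support_iff, coeff_shiftPart] at hm
  by_contra h
  simp [h] at hm

theorem shiftPart_eq_self {t e : ℕ} {p : MvPolynomial V k}
    (hp : ∀ m ∈ p.support, m.degree + t = e) : shiftPart t e p = p := by
  ext m
  rw [coeff_shiftPart]
  split_ifs with h
  · rfl
  · by_contra h'
    exact h (hp m (mem_support_iff.2 (Ne.symm h')))

/-- A functional of degree zero on a graded free module commutes with taking graded parts. -/
theorem shiftPart_map {ι : Type*} [Fintype ι] [DecidableEq ι] (δ : ι → ℕ) (t : ℕ)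
    (φ : (ι → MvPolynomial V k) →ₗ[MvPolynomial V k] MvPolynomial V k)
    (hφ : ∀ b, ∀ m ∈ (φ (Pi.single b 1)).support, m.degree + t = δ b)
    (e : ℕ) (v : ι → MvPolynomial V k) :
    shiftPart t e (φ v) = φ fun b => shiftPart (δ b) e (v b) := by
  rw [LinearMap.pi_apply_eq_sum_univ φ v, LinearMap.pi_apply_eq_sum_univ φ fun b => _,
    shiftPart_sum]
  refine Finset.sum_congr rfl fun b _ => ?_
  have : (fun j => if b = j then (1 : MvPolynomial V k) else 0) = Pi.single b 1 := by
    ext j; simp [Pi.single_apply, eq_comm]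
  simp only [this, smul_eq_mul]
  exact shiftPart_mul (hφ b) e _

theorem mem_span_X_iff {p : MvPolynomial V k} :
    p ∈ Ideal.span (Set.range (X : V → MvPolynomial V k)) ↔ coeff 0 p = 0 := by
  rw [← Set.image_univ, mem_ideal_span_X_image]
  constructor
  · intro h
    by_contra h0
    obtain ⟨i, -, hi⟩ := h 0 (mem_support_iff.2 h0)
    exact hi rfl
  · intro h m hm
    have : m ≠ 0 := by rintro rfl; exact mem_support_iff.1 hm h
    obtain ⟨i, hi⟩ := Finsupp.ne_iff.1 this
    exact ⟨i, Set.mem_univ _, hi⟩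

end GradedParts

/-! ### The linear strand of a minimal graded free resolution -/

section LinearStrand

open MvPolynomial

variable {V k : Type*} [Field k]

theorem sum_eq_zero_of_antisymm {ι M : Type*} [Fintype ι] [AddCommMonoid M] (D : ι → ι → M)
    (h0 : ∀ a, D a a = 0) (h : ∀ a b, D a b + D b a = 0) : ∑ a, ∑ b, D a b = 0 := by
  rw [← Fintype.sum_prod_type']
  refine Finset.sum_involution (fun x _ => x.swap) (fun x _ => h _ _) (fun x _ hx hs => hx ?_)
    (fun _ _ => Finset.mem_univ _) fun _ _ => Prod.swap_swap _
  have : x.2 = x.1 := congrArg Prod.fst hs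
  rw [this, h0]

theorem coeff_sum_X_mul [Fintype V] [DecidableEq V] (q : V → MvPolynomial V k) (m : V →₀ ℕ) :
    coeff m (∑ a, X a * q a) = ∑ a ∈ m.support, coeff (m - Finsupp.single a 1) (q a) := by
  rw [coeff_sum, ← Finset.sum_filter_add_sum_filter_not Finset.univ (· ∈ m.support)]
  rw [Finset.sum_eq_zero (s := Finset.univ.filter (· ∉ m.support)), add_zero]
  · rw [Finset.filter_univ_mem]
    exact Finset.sum_congr rfl fun a ha => by rw [coeff_X_mul', if_pos ha]
  · intro a ha
    rw [coeff_X_mul', if_neg (Finset.mem_filter.1 ha).2]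

theorem coeff_single_sum_X_mul_C [Fintype V] (c : V → k) (a : V) :
    coeff (Finsupp.single a 1) (∑ b, X b * C (c b)) = c a := by
  classical
  rw [coeff_sum_X_mul, Finsupp.support_single _ one_ne_zero]
  simp

/-- A linear form is the sum of its terms. -/
theorem eq_sum_X_mul_C [Fintype V] {p : MvPolynomial V k} (hp : ∀ m ∈ p.support, m.degree = 1) :
    p = ∑ a, X a * C (coeff (Finsupp.single a 1) p) := by
  classical
  ext m
  by_cases hm : m.degree = 1
  · obtain ⟨a, rfl⟩ : ∃ a, m = Finsupp.single a 1 := by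
      obtain ⟨a, ha⟩ : ∃ a, m a ≠ 0 := by
        by_contra! h
        rw [show m = 0 from Finsupp.ext h] at hm
        simp at hm
      refine ⟨a, ?_⟩
      have h1 : Finsupp.single a 1 ≤ m := by
        rw [Finsupp.single_le_iff]; omega
      have h2 : (m - Finsupp.single a 1).degree = 0 := by
        have := congrArg Finsupp.degree (tsub_add_cancel_of_le h1)
        rw [map_add, Finsupp.degree_single] at this
        omega
      rw [Finsupp.degree_eq_zero_iff] at h2
      rw [← tsub_add_cancel_of_le h1, h2, zero_add]
    rw [coeff_single_sum_X_mul_C]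
  · have h1 : coeff m p = 0 := by
      by_contra h
      exact hm (hp m (mem_support_iff.2 h))
    rw [h1, coeff_sum_X_mul]
    refine (Finset.sum_eq_zero fun a ha => ?_).symm
    rw [coeff_C, if_neg]
    intro h
    have h1 : Finsupp.single a 1 ≤ m := by
      rw [Finsupp.single_le_iff]
      have := Finsupp.mem_support_iff.1 ha
      omega
    apply hm
    rw [← tsub_add_cancel_of_le h1, ← h]
    simp

theorem sum_X_mul_sum_X_mul_C_eq_zero_iff [Fintype V] (c : V → V → k) :
    ∑ a, X a * ∑ b, X b * C (c a b) = (0 : MvPolynomial V k) ↔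
      (∀ a, c a a = 0) ∧ ∀ a b, c a b + c b a = 0 := by
  classical
  constructor
  · intro h
    have h0 : ∀ a, c a a = 0 := fun a => by
      have := congrArg (coeff (Finsupp.single a 2)) h
      rw [coeff_sum_X_mul, Finsupp.support_single _ two_ne_zero, Finset.sum_singleton,
        ← Finsupp.single_tsub, coeff_single_sum_X_mul_C, coeff_zero] at this
      exact this
    refine ⟨h0, fun a b => ?_⟩
    by_cases hab : a = b
    · subst hab; simp [h0]
    have := congrArg (coeff (Finsupp.single a 1 + Finsupp.single b 1)) h
    have hs : (Finsupp.single a 1 + Finsupp.single b 1 : V →₀ ℕ).support = {a, b} := by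
      rw [Finsupp.support_add_eq, Finsupp.support_single _ one_ne_zero,
        Finsupp.support_single _ one_ne_zero]
      · rfl
      · rw [Finsupp.support_single _ one_ne_zero,
          Finsupp.support_single _ one_ne_zero]
        simpa using hab
    rw [coeff_sum_X_mul, hs, Finset.sum_pair hab, add_tsub_cancel_left, add_tsub_cancel_right,
      coeff_single_sum_X_mul_C, coeff_single_sum_X_mul_C, coeff_zero] at this
    exact this
  · rintro ⟨h0, h⟩
    simp_rw [Finset.mul_sum]
    refine sum_eq_zero_of_antisymm _ (fun a => by simp [h0]) fun a b => ?_
    have : X a * (X b * C (c a b)) + X b * (X a * C (c b a)) =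
        X a * X b * C (c a b + c b a) := by rw [C_add]; ring
    rw [this, h]; simp

/-- The `n`-th term of the linear strand of an ideal `I` generated in degrees at least `d`, as the
space of cycles in the Koszul complex: families `z` of forms of degree `d` in `I`, indexed by
sequences of `n` variables, which are alternating and satisfy `∑ₐ xₐ z(…, a) = 0`. Alternation is
encoded recursively, by transpositions of the first two entries. -/
def IsStrand (I : Ideal (MvPolynomial V k)) [Fintype V] (d : ℕ) :
    (n : ℕ) → ((Fin n → V) → MvPolynomial V k) → Prop
  | 0, z => z Fin.elim0 ∈ I ∧ ∀ m ∈ (z Fin.elim0).support, m.degree = d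
  | 1, z => (∀ a, IsStrand I d 0 fun β => z (Fin.cons a β)) ∧
      ∑ a, X a * z (Fin.cons a Fin.elim0) = 0
  | n + 2, z => (∀ a, IsStrand I d (n + 1) fun β => z (Fin.cons a β)) ∧
      (∀ a β, z (Fin.cons a (Fin.cons a β)) = 0) ∧
      ∀ a b β, z (Fin.cons a (Fin.cons b β)) + z (Fin.cons b (Fin.cons a β)) = 0

/-- The constant vector of the coefficients of `xₐ` in `v`. -/
noncomputable def linCoeff {ι : Type*} (a : V) :
    (ι → MvPolynomial V k) →ₗ[k] (ι → MvPolynomial V k) :=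
  LinearMap.pi fun b => Algebra.linearMap k (MvPolynomial V k) ∘ₗ
    lcoeff k (Finsupp.single a 1) ∘ₗ LinearMap.proj b

theorem linCoeff_apply {ι : Type*} (a : V) (v : ι → MvPolynomial V k) (b : ι) :
    linCoeff a v b = C (coeff (Finsupp.single a 1) (v b)) := rfl

theorem isHomog_linCoeff {ι : Type*} {δ : ι → ℕ} {e : ℕ} {v : ι → MvPolynomial V k}
    (hv : IsHomog δ (e + 1) v) (a : V) : IsHomog δ e (linCoeff a v) := by
  classical
  intro b m hm
  rw [linCoeff_apply, mem_support_iff, coeff_C] at hm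
  split_ifs at hm with h
  · subst h
    have := hv b _ (mem_support_iff.2 hm)
    rw [Finsupp.degree_single] at this
    simp only [map_zero]
    omega
  · exact absurd rfl hm

theorem eq_sum_linCoeff {ι : Type*} [Fintype V] {δ : ι → ℕ} {e : ℕ} {v : ι → MvPolynomial V k}
    (hv : IsHomog δ (e + 1) v) (hδ : ∀ b, e ≤ δ b) (h0 : ∀ b, coeff 0 (v b) = 0) :
    v = ∑ a, (X a : MvPolynomial V k) • linCoeff a v := by
  ext1 b
  simp only [Finset.sum_apply, Pi.smul_apply, smul_eq_mul, linCoeff_apply]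
  refine eq_sum_X_mul_C fun m hm => ?_
  have h1 := hv b m hm
  have h2 : m.degree ≠ 0 := fun h => by
    rw [Finsupp.degree_eq_zero_iff] at h
    subst h
    exact mem_support_iff.1 hm (h0 b)
  have := hδ b
  omega

theorem linCoeff_sum_X_smul {ι : Type*} [Fintype V] {w : V → ι → MvPolynomial V k}
    (hw : ∀ a b, w a b = C (coeff 0 (w a b))) (a : V) :
    linCoeff a (∑ a, (X a : MvPolynomial V k) • w a) = w a := by
  ext1 b
  rw [linCoeff_apply]
  simp only [Finset.sum_apply, Pi.smul_apply, smul_eq_mul]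
  rw [Finset.sum_congr rfl fun a _ => by rw [hw a b], coeff_single_sum_X_mul_C, ← hw]

theorem IsHomog.eq_C {ι : Type*} {δ : ι → ℕ} {e : ℕ} {v : ι → MvPolynomial V k}
    (hv : IsHomog δ e v) (hδ : ∀ b, e ≤ δ b) (b : ι) : v b = C (coeff 0 (v b)) := by
  classical
  ext m
  rw [coeff_C]
  split_ifs with h
  · rw [h]
  · by_contra hm
    have h1 := hv b m (mem_support_iff.2 hm)
    have := hδ b
    exact h ((Finsupp.degree_eq_zero_iff m).1 (by omega)).symm

theorem isHomog_sum_X_smul {ι : Type*} [Fintype V] {δ : ι → ℕ} {e : ℕ}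
    {w : V → ι → MvPolynomial V k} (hw : ∀ a, IsHomog δ e (w a)) :
    IsHomog δ (e + 1) (∑ a, (X a : MvPolynomial V k) • w a) := by
  classical
  intro b m hm
  simp only [Finset.sum_apply, Pi.smul_apply, smul_eq_mul] at hm
  rw [mem_support_iff, coeff_sum_X_mul] at hm
  obtain ⟨a, ha, h⟩ := Finset.exists_ne_zero_of_sum_ne_zero hm
  have h1 := hw a b _ (mem_support_iff.2 h)
  have h2 : Finsupp.single a 1 ≤ m := by
    rw [Finsupp.single_le_iff]
    have := Finsupp.mem_support_iff.1 ha
    omega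
  have := congrArg Finsupp.degree (tsub_add_cancel_of_le h2)
  rw [map_add, Finsupp.degree_single] at this
  omega

namespace MinimalGradedFreeResolution

variable {I : Ideal (MvPolynomial V k)} (P : MinimalGradedFreeResolution I)

theorem diff_shiftPart (i e : ℕ) (v : Fin (P.rank (i + 1)) → MvPolynomial V k) :
    P.diff i (fun b => shiftPart (P.deg (i + 1) b) e (v b)) =
      fun b => shiftPart (P.deg i b) e (P.diff i v b) := by
  ext1 b
  exact (shiftPart_map (P.deg (i + 1)) (P.deg i b) (LinearMap.proj b ∘ₗ P.diff i)
    (fun c => P.diff_homogeneous i c b) e v).symm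

theorem degree_of_mem_support_aug (b : Fin (P.rank 0)) (m : V →₀ ℕ)
    (hm : m ∈ ((P.aug (Pi.single b 1) : I) : MvPolynomial V k).support) :
    m.degree = P.deg 0 b := by
  rw [Finsupp.degree_eq_weight_one]
  exact P.aug_homogeneous b (mem_support_iff.1 hm)

theorem aug_shiftPart (e : ℕ) (v : Fin (P.rank 0) → MvPolynomial V k) :
    ((P.aug fun b => shiftPart (P.deg 0 b) e (v b) : I) : MvPolynomial V k) =
      shiftPart 0 e (P.aug v : I) :=
  (shiftPart_map (P.deg 0) 0 (Submodule.subtype I ∘ₗ P.aug)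
    (fun c m hm => P.degree_of_mem_support_aug c m hm) e v).symm

theorem coeff_zero_diff (i : ℕ) (v : Fin (P.rank (i + 1)) → MvPolynomial V k)
    (b : Fin (P.rank i)) : coeff 0 (P.diff i v b) = 0 :=
  mem_span_X_iff.1 (P.minimal i v b)

theorem coeff_zero_of_diff_eq_zero {i : ℕ} {v : Fin (P.rank (i + 1)) → MvPolynomial V k}
    (h : P.diff i v = 0) (b : Fin (P.rank (i + 1))) : coeff 0 (v b) = 0 := by
  obtain ⟨w, rfl⟩ := (P.exact_succ i v).1 h
  exact P.coeff_zero_diff _ _ _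

theorem coeff_zero_of_aug_eq_zero {v : Fin (P.rank 0) → MvPolynomial V k}
    (h : P.aug v = 0) (b : Fin (P.rank 0)) : coeff 0 (v b) = 0 := by
  obtain ⟨w, rfl⟩ := (P.exact_zero v).1 h
  exact P.coeff_zero_diff _ _ _

/-- If `I` vanishes in degrees below `d`, then `Fᵢ` is generated in degrees at least `i + d`. -/
theorem le_deg {d : ℕ} (hI : ∀ p ∈ I, ∀ m ∈ p.support, d ≤ m.degree) (i : ℕ)
    (b : Fin (P.rank i)) : i + d ≤ P.deg i b := by
  induction i with
  | zero =>
    have h : (P.aug (Pi.single b 1) : MvPolynomial V k) ≠ 0 := fun h => by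
      simpa using P.coeff_zero_of_aug_eq_zero (Subtype.ext h) b
    obtain ⟨m, hm⟩ := support_nonempty.2 h
    rw [← P.degree_of_mem_support_aug b m hm, zero_add]
    exact hI _ (P.aug (Pi.single b 1)).2 m hm
  | succ i ih =>
    have h : P.diff i (Pi.single b 1) ≠ 0 := fun h => by
      simpa using P.coeff_zero_of_diff_eq_zero h b
    obtain ⟨c, hc⟩ := Function.ne_iff.1 h
    obtain ⟨m, hm⟩ := support_nonempty.2 hc
    have h1 := P.diff_homogeneous i b c m hm
    have h2 : m.degree ≠ 0 := fun h => by
      rw [Finsupp.degree_eq_zero_iff] at h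
      subst h
      exact mem_support_iff.1 hm (P.coeff_zero_diff _ _ _)
    have := ih c
    omega

/-- The comparison of `Fₙ` in degree `n + d` with the Koszul cycles with values in `I`: iterate
taking the coefficients of the variables in the differential. -/
noncomputable def strandMap : (n : ℕ) →
    (Fin (P.rank n) → MvPolynomial V k) →ₗ[k] ((Fin n → V) → MvPolynomial V k)
  | 0 => LinearMap.pi fun _ => (Submodule.subtype I ∘ₗ P.aug).restrictScalars k
  | n + 1 => LinearMap.pi fun α => LinearMap.proj (Fin.tail α) ∘ₗ strandMap n ∘ₗ
      linCoeff (α 0) ∘ₗ (P.diff n).restrictScalars k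

theorem strandMap_zero_apply (v : Fin (P.rank 0) → MvPolynomial V k) (α : Fin 0 → V) :
    P.strandMap 0 v α = P.aug v := rfl

theorem strandMap_succ_cons (n : ℕ) (v : Fin (P.rank (n + 1)) → MvPolynomial V k) (a : V)
    (β : Fin n → V) :
    P.strandMap (n + 1) v (Fin.cons a β) = P.strandMap n (linCoeff a (P.diff n v)) β := by
  rfl

theorem isHomog_diff {i e : ℕ} {v : Fin (P.rank (i + 1)) → MvPolynomial V k}
    (hv : IsHomog (P.deg (i + 1)) e v) : IsHomog (P.deg i) e (P.diff i v) := by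
  have h : (fun b => shiftPart (P.deg (i + 1) b) e (v b)) = v :=
    funext fun b => shiftPart_eq_self (hv b)
  rw [← h, diff_shiftPart]
  exact isHomog_shiftPart _ _ _

theorem exists_homog_diff_eq {i e : ℕ} {w : Fin (P.rank i) → MvPolynomial V k}
    (hw : IsHomog (P.deg i) e w) (h : ∃ v, P.diff i v = w) :
    ∃ v, IsHomog (P.deg (i + 1)) e v ∧ P.diff i v = w := by
  obtain ⟨v, rfl⟩ := h
  refine ⟨_, isHomog_shiftPart (P.deg (i + 1)) e v, ?_⟩
  rw [diff_shiftPart]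
  exact funext fun b => shiftPart_eq_self (hw b)

variable [Fintype V] {d : ℕ}

theorem strandMap_injOn (hI : ∀ p ∈ I, ∀ m ∈ p.support, d ≤ m.degree) (n : ℕ)
    (v : Fin (P.rank n) → MvPolynomial V k) (hv : IsHomog (P.deg n) (n + d) v)
    (h : P.strandMap n v = 0) : v = 0 := by
  induction n with
  | zero =>
    have h1 : P.aug v = 0 := Subtype.ext (congrFun h Fin.elim0)
    ext1 b
    rw [hv.eq_C (P.le_deg hI 0) b, P.coeff_zero_of_aug_eq_zero h1]
    simp
  | succ n ih =>
    have hd : IsHomog (P.deg n) (n + d + 1) (P.diff n v) := by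
      have := P.isHomog_diff hv
      rwa [show n + 1 + d = n + d + 1 by omega] at this
    have h1 : P.diff n v = 0 := by
      rw [eq_sum_linCoeff hd (P.le_deg hI n) (P.coeff_zero_diff n v)]
      refine Finset.sum_eq_zero fun a _ => ?_
      rw [ih _ (isHomog_linCoeff hd a) (funext fun β => congrFun h (Fin.cons a β)), smul_zero]
    ext1 b
    rw [hv.eq_C (P.le_deg hI (n + 1)) b, P.coeff_zero_of_diff_eq_zero h1]
    simp

/-- The second differential vanishes on `v = ∑ₐ xₐ vₐ` exactly if the coefficients of the `vₐ` are
antisymmetric. -/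
theorem diff_sum_X_smul_eq_zero_iff (hI : ∀ p ∈ I, ∀ m ∈ p.support, d ≤ m.degree) (n : ℕ)
    (w : V → Fin (P.rank (n + 1)) → MvPolynomial V k)
    (hw : ∀ a, IsHomog (P.deg (n + 1)) (n + 1 + d) (w a)) :
    P.diff n (∑ a, (X a : MvPolynomial V k) • w a) = 0 ↔
      (∀ a, linCoeff a (P.diff n (w a)) = 0) ∧
      ∀ a b, linCoeff b (P.diff n (w a)) + linCoeff a (P.diff n (w b)) = 0 := by
  have hd : ∀ a, IsHomog (P.deg n) (n + d + 1) (P.diff n (w a)) := fun a => by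
    have := P.isHomog_diff (hw a)
    rwa [show n + 1 + d = n + d + 1 by omega] at this
  have key : ∀ c, P.diff n (∑ a, (X a : MvPolynomial V k) • w a) c =
      ∑ a, X a * ∑ b, X b * C (coeff (Finsupp.single b 1) (P.diff n (w a) c)) := fun c => by
    rw [map_sum, Finset.sum_apply]
    refine Finset.sum_congr rfl fun a _ => ?_
    rw [map_smul, Pi.smul_apply, smul_eq_mul]
    conv_lhs => rw [eq_sum_linCoeff (hd a) (P.le_deg hI n) (P.coeff_zero_diff n (w a))]
    simp only [Finset.sum_apply, Pi.smul_apply, smul_eq_mul, linCoeff_apply]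
  simp only [funext_iff, Pi.add_apply, Pi.zero_apply, key, sum_X_mul_sum_X_mul_C_eq_zero_iff,
    linCoeff_apply, ← C_add, C_eq_zero]
  exact ⟨fun h => ⟨fun a c => (h c).1 a, fun a b c => (h c).2 a b⟩,
    fun h c => ⟨fun a => h.1 a c, fun a b => h.2 a b c⟩⟩

/-- The elements of degree `n + d` of `Fₙ` correspond to the Koszul cycles. -/
theorem isStrand_iff (hI : ∀ p ∈ I, ∀ m ∈ p.support, d ≤ m.degree) (n : ℕ)
    (z : (Fin n → V) → MvPolynomial V k) :
    IsStrand I d n z ↔ ∃ v, IsHomog (P.deg n) (n + d) v ∧ P.strandMap n v = z := by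
  induction n with
  | zero =>
    simp only [IsStrand]
    constructor
    · rintro ⟨h1, h2⟩
      obtain ⟨v, hv⟩ := P.aug_surjective ⟨_, h1⟩
      refine ⟨_, isHomog_shiftPart (P.deg 0) (0 + d) v, ?_⟩
      ext1 α
      rw [strandMap_zero_apply, aug_shiftPart, hv, Subsingleton.elim α Fin.elim0]
      exact shiftPart_eq_self fun m hm => by have := h2 m hm; omega
    · rintro ⟨v, hv, rfl⟩
      refine ⟨(P.aug v).2, fun m hm => ?_⟩
      have h : (fun b => shiftPart (P.deg 0 b) (0 + d) (v b)) = v :=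
        funext fun b => shiftPart_eq_self (hv b)
      rw [strandMap_zero_apply, ← h, aug_shiftPart, mem_support_iff, coeff_shiftPart] at hm
      by_contra h'
      exact hm (if_neg (by omega))
  | succ n ih =>
    have hd : ∀ v, IsHomog (P.deg (n + 1)) (n + 1 + d) v →
        IsHomog (P.deg n) (n + d + 1) (P.diff n v) := fun v hv => by
      have := P.isHomog_diff hv
      rwa [show n + 1 + d = n + d + 1 by omega] at this
    -- a family `z` comes from `v` as soon as `∑ₐ xₐ vₐ` is a cycle, where `vₐ` lifts `z(a, …)`
    have lift : ∀ w : V → Fin (P.rank n) → MvPolynomial V k,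
        (∀ a, IsHomog (P.deg n) (n + d) (w a)) →
        (∀ a, P.strandMap n (w a) = fun β => z (Fin.cons a β)) →
        (∃ v, P.diff n v = ∑ a, (X a : MvPolynomial V k) • w a) →
        ∃ v, IsHomog (P.deg (n + 1)) (n + 1 + d) v ∧ P.strandMap (n + 1) v = z := by
      intro w hw hz hv
      have hh := isHomog_sum_X_smul hw
      rw [show n + d + 1 = n + 1 + d by omega] at hh
      obtain ⟨v, hv1, hv2⟩ := P.exists_homog_diff_eq hh hv
      refine ⟨v, hv1, funext fun α => ?_⟩
      rw [← Fin.cons_self_tail α, strandMap_succ_cons, hv2,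
        linCoeff_sum_X_smul fun a b => (hw a).eq_C (P.le_deg hI n) b, hz]
    cases n with
    | zero =>
      rw [IsStrand]
      constructor
      · rintro ⟨h1, h2⟩
        choose w hw hz using fun a => (ih _).1 (h1 a)
        refine lift w hw hz ((P.exact_zero _).1 ?_)
        ext1
        rw [map_sum, ZeroMemClass.coe_zero, ← h2, AddSubmonoidClass.coe_finsetSum]
        refine Finset.sum_congr rfl fun a _ => ?_
        rw [← congrFun (hz a) Fin.elim0, map_smul]
        rfl
      · rintro ⟨v, hv, rfl⟩
        refine ⟨fun a => (ih _).2 ⟨_, isHomog_linCoeff (hd v hv) a, rfl⟩, ?_⟩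
        have h := (P.exact_zero _).2 ⟨v, rfl⟩
        rw [eq_sum_linCoeff (hd v hv) (P.le_deg hI 0) (P.coeff_zero_diff 0 v), map_sum] at h
        have h' := congrArg (Submodule.subtype I) h
        rw [map_sum, map_zero] at h'
        rw [← h']
        refine Finset.sum_congr rfl fun a _ => ?_
        rw [map_smul]
        rfl
    | succ n =>
      rw [IsStrand]
      constructor
      · rintro ⟨h1, h2, h3⟩
        choose w hw hz using fun a => (ih _).1 (h1 a)
        refine lift w hw hz ((P.exact_succ n _).1 ?_)
        have hw' : ∀ a, IsHomog (P.deg n) (n + d + 1) (P.diff n (w a)) := fun a => by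
          have := P.isHomog_diff (hw a)
          rwa [show n + 1 + d = n + d + 1 by omega] at this
        have hz' : ∀ a b β, P.strandMap n (linCoeff b (P.diff n (w a))) β =
            z (Fin.cons a (Fin.cons b β)) := fun a b β => by
          rw [← congrFun (hz a) (Fin.cons b β), strandMap_succ_cons]
        rw [P.diff_sum_X_smul_eq_zero_iff hI n w hw]
        refine ⟨fun a => P.strandMap_injOn hI n _ (isHomog_linCoeff (hw' a) a) ?_,
          fun a b => P.strandMap_injOn hI n _ ?_ ?_⟩
        · ext1 β
          rw [hz', h2]; rfl
        · classical
          intro c m hm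
          rcases Finset.mem_union.1 (support_add hm) with hm | hm
          · exact isHomog_linCoeff (hw' a) b c m hm
          · exact isHomog_linCoeff (hw' b) a c m hm
        · ext1 β
          rw [map_add, Pi.add_apply, hz', hz', h3]; rfl
      · rintro ⟨v, hv, rfl⟩
        refine ⟨fun a => (ih _).2 ⟨_, isHomog_linCoeff (hd v hv) a, rfl⟩, ?_⟩
        have h := (P.exact_succ n _).2 ⟨v, rfl⟩
        rw [eq_sum_linCoeff (hd v hv) (P.le_deg hI (n + 1)) (P.coeff_zero_diff (n + 1) v),
          P.diff_sum_X_smul_eq_zero_iff hI n _ fun a => isHomog_linCoeff (hd v hv) a] at h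
        constructor
        · intro a β
          rw [strandMap_succ_cons, strandMap_succ_cons, h.1, map_zero]; rfl
        · intro a b β
          rw [strandMap_succ_cons, strandMap_succ_cons, strandMap_succ_cons, strandMap_succ_cons,
            ← Pi.add_apply, ← map_add, h.2, map_zero]; rfl

end MinimalGradedFreeResolution

end LinearStrand

/-! ### Existence of minimal graded free resolutions -/

section Existence

open MvPolynomial

variable {V k : Type*} [Field k]

/-- A submodule of `⨁_b R(-δ b)` is graded if it contains the graded parts of its elements. -/
def IsGraded {ι : Type*} (δ : ι → ℕ) (N : Submodule (MvPolynomial V k) (ι → MvPolynomial V k)) :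
    Prop :=
  ∀ v ∈ N, ∀ e, (fun b => shiftPart (δ b) e (v b)) ∈ N

theorem sum_shiftPart {t n : ℕ} {p : MvPolynomial V k}
    (hn : ∀ m ∈ p.support, m.degree + t < n) : ∑ e ∈ Finset.range n, shiftPart t e p = p := by
  ext m
  simp only [coeff_sum, coeff_shiftPart]
  rw [Finset.sum_ite_eq]
  split_ifs with h
  · rfl
  · by_contra h'
    exact h (Finset.mem_range.2 (hn m (mem_support_iff.2 (Ne.symm h'))))

theorem exists_sum_shiftPart {ι : Type*} [Finite ι] (δ : ι → ℕ) (v : ι → MvPolynomial V k) :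
    ∃ n, ∑ e ∈ Finset.range n, (fun b => shiftPart (δ b) e (v b)) = v := by
  cases nonempty_fintype ι
  refine ⟨∑ b, (∑ m ∈ (v b).support, (m.degree + δ b)) + 1, ?_⟩
  ext1 b
  rw [Finset.sum_apply]
  refine sum_shiftPart fun m hm => Nat.lt_succ_of_le ?_
  exact (Finset.single_le_sum (f := fun m : V →₀ ℕ => m.degree + δ b) (fun _ _ => Nat.zero_le _)
    hm).trans (Finset.single_le_sum (f := fun b => ∑ m ∈ (v b).support, (m.degree + δ b))
      (fun _ _ => Nat.zero_le _) (Finset.mem_univ b))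

/-- Over finitely many variables, a graded submodule has finitely many homogeneous generators. -/
theorem exists_homog_generators [Finite V] {ι : Type*} [Finite ι] (δ : ι → ℕ)
    (N : Submodule (MvPolynomial V k) (ι → MvPolynomial V k)) (hN : IsGraded δ N) :
    ∃ (s : ℕ) (g : Fin s → ι → MvPolynomial V k) (δ' : Fin s → ℕ),
      (∀ j, IsHomog δ (δ' j) (g j)) ∧ Submodule.span (MvPolynomial V k) (Set.range g) = N := by
  classical
  obtain ⟨S, hS⟩ : N.FG := IsNoetherian.noetherian N
  choose n hn using fun v : ι → MvPolynomial V k => exists_sum_shiftPart δ v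
  let T : Finset (Σ _ : ι → MvPolynomial V k, ℕ) := S.sigma fun v => Finset.range (n v)
  let e := T.equivFin
  refine ⟨T.card, fun j b => shiftPart (δ b) (e.symm j).1.2 ((e.symm j).1.1 b),
    fun j => (e.symm j).1.2, fun j => isHomog_shiftPart _ _ _, le_antisymm ?_ ?_⟩
  · rw [Submodule.span_le]
    rintro _ ⟨j, rfl⟩
    refine hN _ ?_ _
    rw [← hS]
    exact Submodule.subset_span (Finset.mem_sigma.1 (e.symm j).2).1
  · conv_lhs => rw [← hS]
    rw [Submodule.span_le]
    intro v hv
    rw [SetLike.mem_coe, ← hn v]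
    refine Submodule.sum_mem _ fun i hi => Submodule.subset_span ⟨e ⟨⟨v, i⟩, ?_⟩, ?_⟩
    · exact Finset.mem_sigma.2 ⟨hv, hi⟩
    · simp

theorem isGraded_ker {ι κ : Type*} [Fintype ι] [DecidableEq ι] (δ : ι → ℕ) (δ' : κ → ℕ)
    (φ : (ι → MvPolynomial V k) →ₗ[MvPolynomial V k] (κ → MvPolynomial V k))
    (hφ : ∀ b, IsHomog δ' (δ b) (φ (Pi.single b 1))) : IsGraded δ (LinearMap.ker φ) := by
  intro v hv e
  rw [LinearMap.mem_ker] at hv ⊢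
  ext1 c
  have h := shiftPart_map δ (δ' c) (LinearMap.proj c ∘ₗ φ) (fun b => hφ b c) e v
  refine h.symm.trans ?_
  rw [LinearMap.comp_apply, hv]
  simp [shiftPart]

/-- A graded submodule is covered by a graded free module with kernel in `𝔪 F`: choose a system of
homogeneous generators of minimal cardinality. -/
theorem exists_minimal_cover [Finite V] {ι : Type*} [Finite ι] (δ : ι → ℕ)
    (N : Submodule (MvPolynomial V k) (ι → MvPolynomial V k)) (hN : IsGraded δ N) :
    ∃ (s : ℕ) (δ' : Fin s → ℕ)
      (φ : (Fin s → MvPolynomial V k) →ₗ[MvPolynomial V k] (ι → MvPolynomial V k)),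
      LinearMap.range φ = N ∧ (∀ j, IsHomog δ (δ' j) (φ (Pi.single j 1))) ∧
      (∀ v ∈ LinearMap.ker φ, ∀ j, coeff 0 (v j) = 0) ∧ IsGraded δ' (LinearMap.ker φ) := by
  classical
  have hex := exists_homog_generators δ N hN
  obtain ⟨g, δ', hg, hspan⟩ := Nat.find_spec hex
  have hmin := fun s (hs : s < Nat.find hex) => Nat.find_min hex hs
  generalize Nat.find hex = s at g δ' hg hspan hmin
  let φ := Fintype.linearCombination (MvPolynomial V k) g
  have hφ : ∀ j, φ (Pi.single j 1) = g j := fun j => by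
    simp [φ, Fintype.linearCombination_apply_single]
  have hhom : ∀ j, IsHomog δ (δ' j) (φ (Pi.single j 1)) := fun j => by
    rw [hφ]; exact hg j
  have hker := isGraded_ker δ' δ φ hhom
  refine ⟨s, δ', φ, (Fintype.range_linearCombination _ _).trans hspan, hhom, ?_, hker⟩
  intro v hv j
  by_contra h0
  -- the part of degree `δ' j` of the relation `v` has a unit as coefficient of the generator `j`
  have hv' := hker v hv (δ' j)
  set w : Fin s → MvPolynomial V k := fun b => shiftPart (δ' b) (δ' j) (v b) with hw
  have hwj : w j = C (coeff 0 (v j)) := by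
    ext m
    rw [hw, coeff_shiftPart, coeff_C]
    by_cases hm : m = 0
    · subst hm; simp
    · rw [if_neg, if_neg (Ne.symm hm)]
      rw [add_eq_right, Finsupp.degree_eq_zero_iff]
      exact hm
  have hsum : ∑ i, w i • g i = 0 := hv'
  cases s with
  | zero => exact j.elim0
  | succ s =>
    refine hmin s (Nat.lt_succ_self s) ⟨g ∘ j.succAbove, δ' ∘ j.succAbove,
      fun i => hg _, le_antisymm ?_ ?_⟩
    · rw [← hspan]
      exact Submodule.span_mono (Set.range_comp_subset_range _ _)
    · conv_lhs => rw [← hspan]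
      rw [Submodule.span_le]
      have hmem : ∀ i, g (j.succAbove i) ∈
          Submodule.span (MvPolynomial V k) (Set.range (g ∘ j.succAbove)) :=
        fun i => Submodule.subset_span ⟨i, rfl⟩
      rintro _ ⟨i, rfl⟩
      rcases Fin.eq_self_or_eq_succAbove j i with rfl | ⟨i, rfl⟩
      · rw [Fin.sum_univ_succAbove _ i, hwj] at hsum
        have h1 : g i = (C (-(coeff 0 (v i))⁻¹) : MvPolynomial V k) • ∑ l, w (i.succAbove l) • g (i.succAbove l) := by
          rw [eq_neg_of_add_eq_zero_right hsum, ← neg_smul, smul_smul, ← C_neg, ← C_mul]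
          rw [neg_mul_neg, inv_mul_cancel₀ h0, C_1, one_smul]
        rw [SetLike.mem_coe, h1]
        exact Submodule.smul_mem _ _ (Submodule.sum_mem _ fun l _ =>
          Submodule.smul_mem _ _ (hmem l))
      · exact hmem i

variable (V k) in
/-- The data carried along in building a minimal resolution: a graded free module `F` and a graded
submodule of `𝔪 F` that remains to be resolved. -/
structure ResolutionStage where
  /-- the rank of `F` -/
  rank : ℕ
  /-- the degrees of the basis elements of `F` -/
  deg : Fin rank → ℕ
  /-- the submodule -/
  syz : Submodule (MvPolynomial V k) (Fin rank → MvPolynomial V k)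
  isGraded : IsGraded deg syz
  coeff_zero : ∀ v ∈ syz, ∀ j, coeff 0 (v j) = 0

theorem ResolutionStage.exists_next [Finite V] (A : ResolutionStage V k) :
    ∃ (B : ResolutionStage V k) (φ : (Fin B.rank → MvPolynomial V k) →ₗ[MvPolynomial V k]
      (Fin A.rank → MvPolynomial V k)), LinearMap.range φ = A.syz ∧ LinearMap.ker φ = B.syz ∧
      ∀ j, IsHomog A.deg (B.deg j) (φ (Pi.single j 1)) := by
  obtain ⟨s, δ', φ, h1, h2, h3, h4⟩ := exists_minimal_cover A.deg A.syz A.isGraded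
  exact ⟨⟨s, δ', LinearMap.ker φ, h4, h3⟩, φ, h1, rfl, h2⟩

/-- Every homogeneous ideal in finitely many variables has a minimal graded free resolution. -/
theorem nonempty_minimalGradedFreeResolution [Finite V] (I : Ideal (MvPolynomial V k))
    (hI : ∀ p ∈ I, ∀ e, shiftPart 0 e p ∈ I) : Nonempty (MinimalGradedFreeResolution I) := by
  let N : Submodule (MvPolynomial V k) (Unit → MvPolynomial V k) :=
    Submodule.comap (LinearMap.proj ()) I
  obtain ⟨s, δ, φ, h1, h2, h3, h4⟩ := exists_minimal_cover (fun _ => 0) N fun v hv e => hI _ hv e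
  choose next map hrange hker hhom using @ResolutionStage.exists_next V k _ _
  let st : ℕ → ResolutionStage V k := fun n =>
    Nat.rec ⟨s, δ, LinearMap.ker φ, h4, h3⟩ (fun _ A => next A) n
  have hmem : ∀ v, φ v () ∈ I := fun v => by
    have : φ v ∈ N := h1 ▸ LinearMap.mem_range_self φ v
    exact this
  let aug : (Fin s → MvPolynomial V k) →ₗ[MvPolynomial V k] I :=
    (LinearMap.proj () ∘ₗ φ).codRestrict I hmem
  have haug : ∀ v, aug v = 0 ↔ φ v = 0 := fun v => by
    rw [Subtype.ext_iff, funext_iff]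
    exact ⟨fun h _ => h, fun h => h ()⟩
  refine ⟨⟨fun n => (st n).rank, fun n => (st n).deg, fun n => map (st n), aug, ?_, ?_, ?_, ?_,
    ?_, ?_⟩⟩
  · rintro ⟨p, hp⟩
    have : (fun _ => p) ∈ LinearMap.range φ := by rw [h1]; exact hp
    obtain ⟨v, hv⟩ := this
    exact ⟨v, Subtype.ext (congrFun hv ())⟩
  · intro v
    have : v ∈ LinearMap.range (map (st 0)) ↔ v ∈ LinearMap.ker φ := by
      rw [hrange]; rfl
    rw [haug]
    exact this.symm
  · intro i v
    have : v ∈ LinearMap.ker (map (st i)) ↔ v ∈ LinearMap.range (map (st (i + 1))) := by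
      rw [hker, hrange]
    exact this
  · intro b m hm
    have h := h2 b () m (mem_support_iff.2 hm)
    rw [Finsupp.degree_eq_weight_one] at h
    exact h
  · exact fun i c b m hm => hhom (st i) c b m hm
  · intro i v b
    rw [mem_span_X_iff]
    refine (st i).coeff_zero _ ?_ b
    rw [← hrange]
    exact LinearMap.mem_range_self _ _

end Existence

/-! ### Leaves and neighbouring facets in a pure simplicial forest -/

namespace FacetFamily

variable {V : Type*} [DecidableEq V]

theorem Linked.symm {S : Set (Finset V)} {F G : Finset V} (h : Linked S F G) : Linked S G F := by
  induction h with
  | refl => exact Relation.ReflTransGen.refl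
  | tail _ h2 ih =>
    exact Relation.ReflTransGen.head ⟨h2.2.1, h2.1, by rw [Finset.inter_comm]; exact h2.2.2⟩ ih

theorem Linked.mono {S T : Set (Finset V)} (hST : S ⊆ T) {F G : Finset V} (h : Linked S F G) :
    Linked T F G :=
  Relation.ReflTransGen.mono (fun _ _ h => ⟨hST h.1, hST h.2.1, h.2.2⟩) F G h

theorem isConnected_component (S : Set (Finset V)) (A : Finset V) :
    IsConnected (component S A) := by
  have key : ∀ F, Linked S A F → Linked (component S A) A F := by
    intro F h
    induction h with
    | refl => exact Relation.ReflTransGen.refl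
    | tail h1 h2 ih =>
      exact ih.tail ⟨⟨h2.1, h1⟩, ⟨h2.2.1, h1.tail h2⟩, h2.2.2⟩
  intro F hF G hG
  exact (key F hF.2).symm.trans (key G hG.2)

/-- Every nonempty subfamily of a pure forest has a member `F` such that, if `F ∖ b` lies in
another member, then `b` lies in no other member: a leaf of a connected component is such. -/
theorem IsForest.exists_leaf {S : Set (Finset V)} (hS : IsForest S) {d : ℕ} (hd : 2 ≤ d)
    (hcard : ∀ F ∈ S, F.card = d) {T : Set (Finset V)} (hT : T ⊆ S) (hne : T.Nonempty) :
    ∃ F ∈ T, ∀ b ∈ F, ∀ F₁ ∈ T, F₁ ≠ F → F.erase b ⊆ F₁ → ∀ F₂ ∈ T, F₂ ≠ F → b ∉ F₂ := by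
  obtain ⟨A, hA⟩ := hne
  have hAc : A ∈ component T A := ⟨hA, Relation.ReflTransGen.refl⟩
  obtain ⟨F, hF, hleaf⟩ := (hS A (hT hA)).2 (component T A)
    (fun G hG => ⟨hT hG.1, hG.2.mono hT⟩) ⟨A, hAc⟩ (isConnected_component T A)
  refine ⟨F, hF.1, fun b hb F₁ h₁ hne₁ hsub F₂ h₂ hne₂ hb₂ => ?_⟩
  have hmem : ∀ G ∈ T, (F ∩ G).Nonempty → G ∈ component T A := fun G hG h =>
    ⟨hG, hF.2.tail ⟨hF.1, hG, h⟩⟩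
  have hsub' : F.erase b ⊆ F ∩ F₁ := Finset.subset_inter (Finset.erase_subset _ _) hsub
  have hc₁ : F₁ ∈ component T A := by
    refine hmem F₁ h₁ (Finset.Nonempty.mono hsub' ?_)
    rw [← Finset.card_pos, Finset.card_erase_of_mem hb, hcard F (hT hF.1)]
    omega
  have hc₂ : F₂ ∈ component T A := hmem F₂ h₂ ⟨b, Finset.mem_inter.2 ⟨hb, hb₂⟩⟩
  rcases hleaf with h | ⟨G, hG, hGF, h⟩
  · rw [h] at hc₁
    exact hne₁ hc₁
  · refine hGF (Finset.eq_of_subset_of_card_le (fun x hx => ?_) ?_).symm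
    · by_cases hxb : x = b
      · subst hxb
        exact (Finset.mem_inter.1 (h F₂ hc₂ hne₂ (Finset.mem_inter.2 ⟨hx, hb₂⟩))).2
      · exact (Finset.mem_inter.1 (h F₁ hc₁ hne₁ (hsub' (Finset.mem_erase.2 ⟨hxb, hx⟩)))).2
    · rw [hcard F (hT hF.1), hcard G (hT hG.1)]

/-- Three facets of a pure forest do not fit into a set with one more element. -/
theorem IsForest.erase_unique {S : Set (Finset V)} (hS : IsForest S) {d : ℕ} (hd : 2 ≤ d)
    (hcard : ∀ F ∈ S, F.card = d) {F : Finset V} {a b b' : V} (hF : F ∈ S) (ha : a ∉ F)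
    (hb : b ∈ F) (hb' : b' ∈ F) (h₁ : insert a (F.erase b) ∈ S)
    (h₂ : insert a (F.erase b') ∈ S) : b = b' := by
  by_contra hne
  obtain ⟨X, hX, hleaf⟩ := hS.exists_leaf hd hcard
    (T := {F, insert a (F.erase b), insert a (F.erase b')}) (by grind) ⟨F, by simp⟩
  have n1 : insert a (F.erase b) ≠ F := by grind
  have n2 : insert a (F.erase b') ≠ F := by grind
  have n3 : insert a (F.erase b) ≠ insert a (F.erase b') := by grind
  rcases hX with rfl | rfl | rfl
  · exact hleaf b hb _ (by simp) n1 (by grind) _ (by simp) n2 (by grind)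
  · exact hleaf a (by grind) F (by simp) n1.symm (by grind) (insert a (F.erase b')) (by simp)
      n3.symm (by grind)
  · exact hleaf a (by grind) F (by simp) n2.symm (by grind) (insert a (F.erase b)) (by simp)
      n3 (by grind)

/-- If two neighbours `F ∖ b ∪ a` and `F ∖ b' ∪ a'` of a facet `F` of a pure forest are such that
the first has a neighbour of the form `(F ∖ b ∪ a) ∖ e ∪ a'`, then they arise by removing the same
vertex: otherwise the four facets would form a family without a leaf. -/
theorem IsForest.erase_unique_of_exchange {S : Set (Finset V)} (hS : IsForest S) {d : ℕ}
    (hd : 2 ≤ d) (hcard : ∀ F ∈ S, F.card = d) {F : Finset V} {a a' b b' e : V} (hF : F ∈ S)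
    (ha : a ∉ F) (ha' : a' ∉ F) (haa' : a ≠ a') (hb : b ∈ F) (hb' : b' ∈ F)
    (h₁ : insert a (F.erase b) ∈ S) (h₂ : insert a' (F.erase b') ∈ S)
    (h₃ : insert a' ((insert a (F.erase b)).erase e) ∈ S) : b = b' := by
  by_cases he : e = a
  · subst he
    refine hS.erase_unique hd hcard hF ha' hb hb' ?_ h₂
    rwa [Finset.erase_insert (by grind)] at h₃
  by_contra hne
  obtain ⟨F₁, hF₁⟩ : ∃ F₁, F₁ = insert a (F.erase b) := ⟨_, rfl⟩
  obtain ⟨F₂, hF₂⟩ : ∃ F₂, F₂ = insert a' (F.erase b') := ⟨_, rfl⟩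
  obtain ⟨F₃, hF₃⟩ : ∃ F₃, F₃ = insert a' (F₁.erase e) := ⟨_, rfl⟩
  rw [← hF₁, ← hF₃] at h₃
  rw [← hF₁] at h₁
  rw [← hF₂] at h₂
  have m1 : a ∈ F₁ := by rw [hF₁]; exact Finset.mem_insert_self _ _
  have m2 : a' ∈ F₂ := by rw [hF₂]; exact Finset.mem_insert_self _ _
  have m3 : a' ∈ F₃ := by rw [hF₃]; exact Finset.mem_insert_self _ _
  have m4 : a ∈ F₃ := by
    rw [hF₃]; exact Finset.mem_insert_of_mem (Finset.mem_erase.2 ⟨Ne.symm he, m1⟩)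
  have m5 : a' ∉ F₁ := by simp [hF₁, haa'.symm, ha']
  have m6 : a ∉ F₂ := by simp [hF₂, haa', ha]
  have m7 : b ∈ F₂ := by simp [hF₂, hne, hb]
  have e1 : F.erase b ⊆ F₁ := by rw [hF₁]; exact Finset.subset_insert _ _
  have e2 : F₁.erase a ⊆ F := by
    rw [hF₁, Finset.erase_insert (by simp [ha])]; exact Finset.erase_subset _ _
  have e3 : F₂.erase a' ⊆ F := by
    rw [hF₂, Finset.erase_insert (by simp [ha'])]; exact Finset.erase_subset _ _
  have e4 : F₃.erase a' ⊆ F₁ := by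
    rw [hF₃, Finset.erase_insert (by simp [m5])]; exact Finset.erase_subset _ _
  have n1 : F₁ ≠ F := fun h => ha (h ▸ m1)
  have n2 : F₂ ≠ F := fun h => ha' (h ▸ m2)
  have n3 : F₁ ≠ F₃ := fun h => m5 (h ▸ m3)
  have n4 : F₂ ≠ F₃ := fun h => m6 (h ▸ m4)
  have hT : ({F, F₁, F₂, F₃} : Set (Finset V)) ⊆ S := by
    rintro X (rfl | rfl | rfl | rfl) <;> assumption
  obtain ⟨X, hX, hleaf⟩ := hS.exists_leaf hd hcard hT ⟨F, by simp⟩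
  clear hF₁ hF₂ hF₃
  rcases hX with rfl | rfl | rfl | rfl
  · exact hleaf b hb F₁ (by simp) n1 e1 F₂ (by simp) n2 m7
  · exact hleaf a m1 F (by simp) n1.symm e2 F₃ (by simp) n3.symm m4
  · exact hleaf a' m2 F (by simp) n2.symm e3 F₃ (by simp) n4.symm m3
  · exact hleaf a' m3 F₁ (by simp) n3 e4 F₂ (by simp) n4 m2

end FacetFamily

/-! ### The facet ideal in degree `d` -/

section FacetIdeal

open MvPolynomial

/-- The exponent of the squarefree monomial `∏ x ∈ F, x`. -/
noncomputable def expo {V : Type*} (F : Finset V) : V →₀ ℕ := ∑ x ∈ F, Finsupp.single x 1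

variable {V k : Type*} [Field k]

theorem expo_apply [DecidableEq V] (F : Finset V) (a : V) : expo F a = if a ∈ F then 1 else 0 := by
  simp [expo, Finsupp.finsetSum_apply, Finsupp.single_apply]

theorem degree_expo (F : Finset V) : (expo F).degree = F.card := by
  simp [expo, map_sum, Finsupp.degree_single]

theorem expo_injective : Function.Injective (expo : Finset V → V →₀ ℕ) := by
  classical
  intro F G h
  ext a
  have := DFunLike.congr_fun h a
  rw [expo_apply, expo_apply] at this
  by_cases h1 : a ∈ F <;> by_cases h2 : a ∈ G <;> simp_all

theorem expo_insert [DecidableEq V] {G : Finset V} {s : V} (hs : s ∉ G) :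
    expo (insert s G) = expo G + Finsupp.single s 1 := by
  rw [expo, Finset.sum_insert hs, add_comm]; rfl

theorem prod_X_eq_monomial (F : Finset V) :
    ∏ x ∈ F, (X x : MvPolynomial V k) = monomial (expo F) 1 := by
  rw [expo, monomial_sum_one]; rfl

/-- Comparing the two ways of writing a monomial of degree one more than that of a facet. -/
theorem eq_insert_erase_of_expo_add_single_eq [DecidableEq V] {F F' : Finset V} {a b : V}
    (hab : a ≠ b) (h : expo F + Finsupp.single a 1 = expo F' + Finsupp.single b 1) :
    a ∉ F ∧ b ∈ F ∧ F' = insert a (F.erase b) := by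
  have key : ∀ x, (if x ∈ F then 1 else 0) + (if a = x then 1 else 0) =
      (if x ∈ F' then 1 else 0) + (if b = x then 1 else 0) := fun x => by
    have := DFunLike.congr_fun h x
    simpa [expo_apply, Finsupp.single_apply] using this
  have ha : a ∉ F := fun h1 => by
    have := key a
    rw [if_pos h1, if_pos rfl, if_neg hab.symm] at this
    split_ifs at this <;> omega
  have hb : b ∈ F := by
    by_contra h1
    have := key b
    rw [if_neg h1, if_neg hab, if_pos rfl] at this
    split_ifs at this <;> omega
  refine ⟨ha, hb, ?_⟩
  ext x
  have := key x
  rw [Finset.mem_insert, Finset.mem_erase]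
  grind

namespace AbstractSimplicialComplex

variable {Δ : AbstractSimplicialComplex V} {d : ℕ}

theorem mem_facetIdeal_iff {p : MvPolynomial V k} :
    p ∈ Δ.facetIdeal k ↔ ∀ m ∈ p.support, ∃ F ∈ Δ.facets, expo F ≤ m := by
  have h : Δ.facetIdeal k = Ideal.span ((fun s => monomial s (1 : k)) '' (expo '' Δ.facets)) := by
    rw [facetIdeal]
    congr 1
    ext p
    simp only [Set.mem_ofPred_eq, Set.image_image, Set.mem_image, prod_X_eq_monomial, eq_comm]
  rw [h, mem_ideal_span_monomial_image]
  simp only [Set.exists_mem_image]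

theorem monomial_expo_mem_facetIdeal {F : Finset V} (hF : F ∈ Δ.facets) :
    (monomial (expo F) 1 : MvPolynomial V k) ∈ Δ.facetIdeal k :=
  Ideal.subset_span ⟨F, hF, (prod_X_eq_monomial F).symm⟩

theorem le_degree_of_mem_facetIdeal (hpure : Δ.IsPureOfCard d) :
    ∀ p ∈ Δ.facetIdeal k, ∀ m ∈ p.support, d ≤ m.degree := by
  intro p hp m hm
  obtain ⟨F, hF, hle⟩ := mem_facetIdeal_iff.1 hp m hm
  rw [← hpure F hF, ← degree_expo]
  exact Finsupp.degree_mono hle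

theorem exists_facet_of_mem_support (hpure : Δ.IsPureOfCard d) {p : MvPolynomial V k}
    (hp : p ∈ Δ.facetIdeal k) {m : V →₀ ℕ} (hm : m ∈ p.support) (hmd : m.degree = d) :
    ∃ F ∈ Δ.facets, m = expo F := by
  obtain ⟨F, hF, hle⟩ := mem_facetIdeal_iff.1 hp m hm
  refine ⟨F, hF, ?_⟩
  have h := congrArg Finsupp.degree (tsub_add_cancel_of_le hle)
  rw [map_add, degree_expo, hpure F hF, hmd] at h
  have h0 : m - expo F = 0 := (Finsupp.degree_eq_zero_iff _).1 (by omega)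
  rw [← tsub_add_cancel_of_le hle, h0, zero_add]

theorem shiftPart_mem_facetIdeal (p : MvPolynomial V k) (hp : p ∈ Δ.facetIdeal k) (e : ℕ) :
    shiftPart 0 e p ∈ Δ.facetIdeal k := by
  refine mem_facetIdeal_iff.2 fun m hm => mem_facetIdeal_iff.1 hp m ?_
  rw [mem_support_iff, coeff_shiftPart] at hm
  exact mem_support_iff.2 fun h => hm (by rw [h, ite_self])

end AbstractSimplicialComplex

end FacetIdeal

/-! ### Counting basis elements in the linear strand -/

section Counting

open MvPolynomial

variable {V k : Type*} [Field k] [Fintype V]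

/-- If the Koszul cycles have coordinates indexed by `B`, then `|B|` is the Betti number. -/
theorem MinimalGradedFreeResolution.betti_eq_card {I : Ideal (MvPolynomial V k)}
    (P : MinimalGradedFreeResolution I) {d : ℕ} (hI : ∀ p ∈ I, ∀ m ∈ p.support, d ≤ m.degree)
    (n : ℕ) {B : Type*} [Fintype B] [DecidableEq B]
    (ev : ((Fin n → V) → MvPolynomial V k) →ₗ[k] (B → k))
    (hinj : ∀ z, IsStrand I d n z → ev z = 0 → z = 0)
    (hsurj : ∀ b, ∃ z, IsStrand I d n z ∧ ev z = Pi.single b 1) :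
    P.betti n (n + d) = Fintype.card B := by
  let J : ({b // P.deg n b = n + d} → k) →ₗ[k] (Fin (P.rank n) → MvPolynomial V k) :=
    LinearMap.pi fun b => if h : P.deg n b = n + d then
      Algebra.linearMap k (MvPolynomial V k) ∘ₗ LinearMap.proj ⟨b, h⟩ else 0
  have hJ : ∀ c b (h : P.deg n b = n + d), J c b = C (c ⟨b, h⟩) := fun c b h => by
    simp only [J, LinearMap.pi_apply, dif_pos h]; rfl
  have hJ0 : ∀ c b, P.deg n b ≠ n + d → J c b = 0 := fun c b h => by
    simp only [J, LinearMap.pi_apply, dif_neg h]; rfl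
  have hJhom : ∀ c, IsHomog (P.deg n) (n + d) (J c) := by
    classical
    intro c b m hm
    by_cases h : P.deg n b = n + d
    · rw [hJ c b h, mem_support_iff, coeff_C] at hm
      split_ifs at hm with h'
      · subst h'; simpa using h
      · exact absurd rfl hm
    · rw [hJ0 c b h] at hm
      simp at hm
  have hJsurj : ∀ v, IsHomog (P.deg n) (n + d) v → ∃ c, J c = v := fun v hv => by
    refine ⟨fun b => coeff 0 (v b.1), funext fun b => ?_⟩
    rw [hv.eq_C (P.le_deg hI n) b]
    by_cases h : P.deg n b = n + d
    · rw [hJ _ b h]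
    · rw [hJ0 _ b h]
      by_contra h'
      have := hv b 0 (mem_support_iff.2 fun h'' => h' (by rw [h'', C_0]))
      simp only [map_zero] at this
      omega
  let T : ({b // P.deg n b = n + d} → k) →ₗ[k] (B → k) := ev ∘ₗ P.strandMap n ∘ₗ J
  have hTinj : Function.Injective T := by
    rw [injective_iff_map_eq_zero]
    intro c hc
    have h1 := hinj _ ((P.isStrand_iff hI n _).2 ⟨J c, hJhom c, rfl⟩) hc
    have h2 := P.strandMap_injOn hI n _ (hJhom c) h1
    ext ⟨b, hb⟩
    have := congrFun h2 b
    rw [hJ c b hb] at this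
    simpa using this
  have hTsurj : Function.Surjective T := by
    rw [← LinearMap.range_eq_top, eq_top_iff, ← (Pi.basisFun k B).span_eq, Submodule.span_le]
    rintro _ ⟨b, rfl⟩
    obtain ⟨z, hz, hzb⟩ := hsurj b
    obtain ⟨v, hv, rfl⟩ := (P.isStrand_iff hI n z).1 hz
    obtain ⟨c, rfl⟩ := hJsurj v hv
    exact ⟨c, by rw [Pi.basisFun_apply, ← hzb]; rfl⟩
  have h := (LinearEquiv.ofBijective T ⟨hTinj, hTsurj⟩).finrank_eq
  rw [Module.finrank_fintype_fun_eq_card, Module.finrank_fintype_fun_eq_card] at h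
  rw [← h, betti, Fintype.card_subtype]

variable {I : Ideal (MvPolynomial V k)} {d : ℕ}

theorem IsStrand.mem {n : ℕ} {z : (Fin n → V) → MvPolynomial V k} (hz : IsStrand I d n z)
    (α : Fin n → V) : z α ∈ I ∧ ∀ m ∈ (z α).support, m.degree = d := by
  induction n with
  | zero => rw [Subsingleton.elim α Fin.elim0]; exact hz
  | succ n ih =>
    rw [← Fin.cons_self_tail α]
    cases n with
    | zero => exact ih (hz.1 (α 0)) _
    | succ n => exact ih (hz.1 (α 0)) _

/-- The Koszul cycle condition holds in every position. -/
theorem IsStrand.sum_X_mul_update {n : ℕ} {z : (Fin n → V) → MvPolynomial V k}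
    (hz : IsStrand I d n z) (α : Fin n → V) (j : Fin n) :
    ∑ a, X a * z (Function.update α j a) = 0 := by
  induction n with
  | zero => exact j.elim0
  | succ n ih =>
    rw [← Fin.cons_self_tail α]
    cases n with
    | zero =>
      rw [show j = 0 from Fin.fin_one_eq_zero j, ← hz.2]
      refine Finset.sum_congr rfl fun a _ => ?_
      rw [Fin.update_cons_zero, Subsingleton.elim (Fin.tail α) Fin.elim0]
    | succ n =>
      refine Fin.cases ?_ (fun i => ?_) j
      · have h := ih (hz.1 (Fin.tail α 0)) (Fin.tail α) 0
        rw [← neg_eq_zero, ← Finset.sum_neg_distrib] at h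
        rw [← h]
        refine Finset.sum_congr rfl fun a _ => ?_
        obtain ⟨b, β, hβ⟩ : ∃ b β, Fin.tail α = Fin.cons b β :=
          ⟨_, _, (Fin.cons_self_tail _).symm⟩
        rw [hβ, Fin.update_cons_zero, Fin.update_cons_zero, Fin.cons_zero,
          eq_neg_of_add_eq_zero_left (hz.2.2 a b β), mul_neg]
      · simp_rw [← Fin.cons_update]
        exact ih (hz.1 (α 0)) (Fin.tail α) i

end Counting

/-! ### Koszul cycles with values in the facet ideal of a forest -/

section Exchange

open MvPolynomial

variable {V k : Type*} [Field k] [Fintype V]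
  {Δ : AbstractSimplicialComplex V} {d n : ℕ} {z : (Fin n → V) → MvPolynomial V k}

theorem IsStrand.mem_facets (hpure : Δ.IsPureOfCard d) (hz : IsStrand (Δ.facetIdeal k) d n z)
    {α : Fin n → V} {F : Finset V} (h : coeff (expo F) (z α) ≠ 0) : F ∈ Δ.facets := by
  have hm := mem_support_iff.2 h
  obtain ⟨F', hF', heq⟩ := AbstractSimplicialComplex.exists_facet_of_mem_support hpure
    (hz.mem α).1 hm ((hz.mem α).2 _ hm)
  rwa [expo_injective heq]

variable [DecidableEq V]

/-- If the term `x^F` occurs in `z(α)`, then, in the cycle condition in position `j`, the term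
`x_{α j} x^F` has to cancel against another one. -/
theorem IsStrand.exists_exchange (hpure : Δ.IsPureOfCard d)
    (hz : IsStrand (Δ.facetIdeal k) d n z) {α : Fin n → V} {F : Finset V}
    (h : coeff (expo F) (z α) ≠ 0) (j : Fin n) :
    α j ∉ F ∧ ∃ b ∈ F,
      coeff (expo (insert (α j) (F.erase b))) (z (Function.update α j b)) ≠ 0 := by
  have hrel := congrArg (coeff (expo F + Finsupp.single (α j) 1)) (hz.sum_X_mul_update α j)
  rw [coeff_sum_X_mul, coeff_zero] at hrel
  have hj : α j ∈ (expo F + Finsupp.single (α j) 1).support := by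
    rw [Finsupp.mem_support_iff, Finsupp.add_apply, Finsupp.single_eq_same]
    omega
  obtain ⟨b, hb, hbj, hne⟩ : ∃ b ∈ (expo F + Finsupp.single (α j) 1).support, b ≠ α j ∧
      coeff (expo F + Finsupp.single (α j) 1 - Finsupp.single b 1)
        (z (Function.update α j b)) ≠ 0 := by
    by_contra! hall
    rw [Finset.sum_eq_single_of_mem _ hj hall, Function.update_eq_self,
      add_tsub_cancel_right] at hrel
    exact h hrel
  have hm := mem_support_iff.2 hne
  obtain ⟨F', hF', heq⟩ := AbstractSimplicialComplex.exists_facet_of_mem_support hpure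
    (hz.mem _).1 hm ((hz.mem _).2 _ hm)
  have hle : Finsupp.single b 1 ≤ expo F + Finsupp.single (α j) 1 := by
    rw [Finsupp.single_le_iff]
    have := Finsupp.mem_support_iff.1 hb
    omega
  have h2 : expo F + Finsupp.single (α j) 1 = expo F' + Finsupp.single b 1 := by
    rw [← heq, tsub_add_cancel_of_le hle]
  obtain ⟨h3, h4, h5⟩ := eq_insert_erase_of_expo_add_single_eq hbj.symm h2
  refine ⟨h3, b, h4, ?_⟩
  rw [← h5, ← heq]
  exact hne

theorem IsStrand.injective_of_coeff_ne_zero (hpure : Δ.IsPureOfCard d)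
    (hz : IsStrand (Δ.facetIdeal k) d n z) {α : Fin n → V} {F : Finset V}
    (h : coeff (expo F) (z α) ≠ 0) : Function.Injective α := by
  intro i j hij
  by_contra hne
  obtain ⟨-, b, -, hb⟩ := hz.exists_exchange hpure h i
  have := (hz.exists_exchange hpure hb j).1
  rw [Function.update_of_ne (Ne.symm hne), ← hij] at this
  exact this (Finset.mem_insert_self _ _)

/-- In a forest, the vertex exchanged does not depend on the position. -/
theorem IsStrand.exists_common_exchange (hd : 2 ≤ d) (hpure : Δ.IsPureOfCard d)
    (hforest : Δ.IsForest) (hz : IsStrand (Δ.facetIdeal k) d n z) (hn : 0 < n) {α : Fin n → V}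
    {F : Finset V} (h : coeff (expo F) (z α) ≠ 0) :
    ∃ b ∈ F, ∀ j, insert (α j) (F.erase b) ∈ Δ.facets := by
  have hα := hz.injective_of_coeff_ne_zero hpure h
  have hF := hz.mem_facets hpure h
  choose hnot b hb hne using hz.exists_exchange hpure h
  refine ⟨b ⟨0, hn⟩, hb _, fun j => ?_⟩
  suffices hbj : b ⟨0, hn⟩ = b j by rw [hbj]; exact hz.mem_facets hpure (hne j)
  by_cases hj : ⟨0, hn⟩ = j
  · rw [hj]
  obtain ⟨-, e, -, he⟩ := hz.exists_exchange hpure (hne ⟨0, hn⟩) j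
  rw [Function.update_of_ne (Ne.symm hj)] at he
  exact FacetFamily.IsForest.erase_unique_of_exchange hforest hd hpure hF (hnot _) (hnot j)
    (fun h => hj (hα h)) (hb _) (hb j) (hz.mem_facets hpure (hne _))
    (hz.mem_facets hpure (hne j)) (hz.mem_facets hpure he)

/-- Let all `G ∪ γ j` be facets. If `z(γ₀, …, γₙ₋₁)` has the term `x^G x_{γ n}`, then this remains
so after any permutation of `γ`: for transpositions with the last entry, this is the exchange of
vertices, and these transpositions generate the symmetric group. -/
theorem IsStrand.coeff_perm_ne_zero (hd : 2 ≤ d) (hpure : Δ.IsPureOfCard d)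
    (hforest : Δ.IsForest) (hz : IsStrand (Δ.facetIdeal k) d n z) {G : Finset V}
    {γ : Fin (n + 1) → V} (hG : ∀ j, γ j ∉ G ∧ insert (γ j) G ∈ Δ.facets)
    (h : coeff (expo (insert (γ (Fin.last n)) G)) (z (Fin.init γ)) ≠ 0)
    (σ : Equiv.Perm (Fin (n + 1))) :
    coeff (expo (insert ((γ ∘ σ) (Fin.last n)) G)) (z (Fin.init (γ ∘ σ))) ≠ 0 := by
  let Q : (Fin (n + 1) → V) → Prop := fun γ =>
    (∀ j, γ j ∉ G ∧ insert (γ j) G ∈ Δ.facets) ∧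
      coeff (expo (insert (γ (Fin.last n)) G)) (z (Fin.init γ)) ≠ 0
  have hlast : ∀ γ, Q γ → ∀ i, Q (γ ∘ Equiv.swap i (Fin.last n)) := by
    rintro γ ⟨hγ, hne⟩ i
    refine ⟨fun j => hγ _, ?_⟩
    refine Fin.lastCases ?_ (fun i => ?_) i
    · simpa using hne
    obtain ⟨h1, b, hb, hbne⟩ := hz.exists_exchange hpure hne i
    have hbl : b = γ (Fin.last n) := by
      refine FacetFamily.IsForest.erase_unique hforest hd hpure (hγ (Fin.last n)).2 h1 hb
        (Finset.mem_insert_self _ _) (hz.mem_facets hpure hbne) ?_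
      rw [Finset.erase_insert (hγ _).1]
      exact (hγ i.castSucc).2
    subst hbl
    rw [Finset.erase_insert (hγ _).1] at hbne
    have e1 : Fin.init (γ ∘ Equiv.swap i.castSucc (Fin.last n)) =
        Function.update (Fin.init γ) i (γ (Fin.last n)) := by
      ext1 j
      by_cases hj : j = i
      · subst hj
        simp [Fin.init]
      · have h1 : j.castSucc ≠ i.castSucc := fun h => hj (Fin.castSucc_injective _ h)
        rw [Function.update_of_ne hj, Fin.init, Function.comp_apply,
          Equiv.swap_apply_of_ne_of_ne h1 (Fin.castSucc_lt_last j).ne]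
        rfl
    rw [e1, Function.comp_apply, Equiv.swap_apply_right]
    exact hbne
  have hswap : ∀ i j γ, Q γ → Q (γ ∘ Equiv.swap i j) := by
    intro i j γ hγ
    by_cases hil : i = Fin.last n
    · subst hil
      rw [Equiv.swap_comm]
      exact hlast γ hγ j
    by_cases hij : i = j
    · subst hij
      simpa using hγ
    have : γ ∘ Equiv.swap i j = ((γ ∘ Equiv.swap j (Fin.last n)) ∘ Equiv.swap i (Fin.last n)) ∘
        Equiv.swap j (Fin.last n) := by
      rw [Function.comp_assoc, Function.comp_assoc, ← Equiv.Perm.coe_mul, ← Equiv.Perm.coe_mul]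
      congr 2
      rw [Equiv.swap_comm i j, ← Equiv.swap_mul_swap_mul_swap hil hij,
        Equiv.swap_comm (Fin.last n) j, mul_assoc]
    rw [this]
    exact hlast _ (hlast _ (hlast _ hγ j) i) j
  have hall : ∀ σ : Equiv.Perm (Fin (n + 1)), ∀ γ, Q γ → Q (γ ∘ σ) := by
    intro σ
    induction σ using Equiv.Perm.swap_induction_on with
    | one => exact fun γ h => h
    | swap_mul f x y _ ih =>
      intro γ hγ
      exact ih _ (hswap x y γ hγ)
  exact (hall σ γ ⟨hG, h⟩).2

end Exchange

/-! ### Cycles supported on a link -/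

section LinkCycle

open MvPolynomial

variable {V k : Type*} [Field k] [Fintype V]

/-- An alternating function `f` of `n + 1` variables from the link of `G` gives a Koszul cycle. -/
theorem isStrand_of_alternating {I : Ideal (MvPolynomial V k)} {G : Finset V} {n : ℕ}
    (f : (Fin (n + 1) → V) → k)
    (h0 : ∀ γ, ¬ Function.Injective γ → f γ = 0)
    (hswap : ∀ γ i j, i ≠ j → f (γ ∘ Equiv.swap i j) = - f γ)
    (hI : ∀ γ, f γ ≠ 0 → monomial (expo G) 1 * X (γ (Fin.last n)) ∈ I) :
    IsStrand I (G.card + 1) n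
      fun α => ∑ s, C (f (Fin.snoc α s)) * (monomial (expo G) 1 * X s) := by
  classical
  induction n with
  | zero =>
    refine ⟨Ideal.sum_mem _ fun s _ => ?_, fun m hm => ?_⟩
    · by_cases h : f (Fin.snoc Fin.elim0 s) = 0
      · simp [h]
      · have := hI _ h
        rw [Fin.snoc_last] at this
        exact Ideal.mul_mem_left _ _ this
    · rw [mem_support_iff, coeff_sum] at hm
      obtain ⟨s, -, hs⟩ := Finset.exists_ne_zero_of_sum_ne_zero hm
      rw [coeff_C_mul, X, monomial_mul, coeff_monomial] at hs
      split_ifs at hs with h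
      · rw [← h, map_add, degree_expo, Finsupp.degree_single]
      · simp at hs
  | succ n ih =>
    have hrec : ∀ a, IsStrand I (G.card + 1) n fun β =>
        ∑ s, C (f (Fin.snoc (Fin.cons a β : Fin (n + 1) → V) s)) *
          (monomial (expo G) 1 * X s) := by
      intro a
      have := ih (fun γ => f (Fin.cons a γ)) (fun γ hγ => h0 _ fun h => hγ ?_)
        (fun γ i j hij => ?_) (fun γ hγ => ?_)
      · simpa only [Fin.cons_snoc_eq_snoc_cons] using this
      · exact (Fin.cons_injective_iff.1 h).2
      · rw [← hswap (Fin.cons a γ) i.succ j.succ fun h => hij (Fin.succ_injective _ h)]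
        congr 1
        ext1 l
        refine Fin.cases ?_ (fun l => ?_) l
        · simp only [Fin.cons_zero, Function.comp_apply]
          rw [Equiv.swap_apply_of_ne_of_ne (Fin.succ_ne_zero _).symm (Fin.succ_ne_zero _).symm,
            Fin.cons_zero]
        · simp only [Fin.cons_succ, Function.comp_apply]
          rw [(Fin.succ_injective _).swap_apply, Fin.cons_succ]
      · have := hI _ hγ
        rwa [← Fin.succ_last, Fin.cons_succ] at this
    have hneg : ∀ (a b : V) (β : Fin n → V),
        f (Fin.cons a (Fin.cons b β)) + f (Fin.cons b (Fin.cons a β)) = 0 := by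
      intro a b β
      rw [← neg_eq_iff_add_eq_zero, ← hswap _ 0 1 (by simp)]
      congr 1
      ext1 l
      refine Fin.cases ?_ (fun l => Fin.cases ?_ (fun l => ?_) l) l
      · simp
      · simp
      · rw [Function.comp_apply, Equiv.swap_apply_of_ne_of_ne (by simp)
          (fun h => by simp [Fin.ext_iff] at h)]
        rfl
    have hzero : ∀ (a : V) (β : Fin n → V), f (Fin.cons a (Fin.cons a β)) = 0 := by
      intro a β
      refine h0 _ fun h => ?_
      have := @h 0 1 (by simp)
      simp at this
    cases n with
    | zero =>
      refine ⟨hrec, ?_⟩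
      simp_rw [Finset.mul_sum]
      have hs : ∀ a s : V, (Fin.snoc (Fin.cons a Fin.elim0 : Fin 1 → V) s : Fin 2 → V) =
          Fin.cons a (Fin.cons s Fin.elim0) := fun a s => by
        rw [← Fin.cons_snoc_eq_snoc_cons]
        congr 1
        ext1 j
        rw [Fin.fin_one_eq_zero j]
        rfl
      refine sum_eq_zero_of_antisymm _ (fun a => ?_) fun a b => ?_
      · rw [hs, hzero]; simp
      · have := eq_neg_of_add_eq_zero_left (hneg a b Fin.elim0)
        rw [hs, hs, this, C_neg]
        ring
    | succ n =>
      refine ⟨hrec, fun a β => ?_, fun a b β => ?_⟩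
      · refine Finset.sum_eq_zero fun s _ => ?_
        rw [← Fin.cons_snoc_eq_snoc_cons, ← Fin.cons_snoc_eq_snoc_cons, hzero]
        simp
      · rw [← Finset.sum_add_distrib]
        refine Finset.sum_eq_zero fun s _ => ?_
        rw [← Fin.cons_snoc_eq_snoc_cons, ← Fin.cons_snoc_eq_snoc_cons,
          ← Fin.cons_snoc_eq_snoc_cons, ← Fin.cons_snoc_eq_snoc_cons, ← add_mul, ← C_add, hneg]
        simp

end LinkCycle

/-! ### The Betti numbers of the linear strand -/

namespace AbstractSimplicialComplex

open MvPolynomial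

variable {V : Type*} [Fintype V] {Δ : AbstractSimplicialComplex V} {d : ℕ}

theorem mem_facesOfCard {G : Finset V} {m : ℕ} :
    G ∈ Δ.facesOfCard m ↔ G ∈ Δ.faces ∧ G.card = m := by
  simp [facesOfCard]

variable [DecidableEq V]

open Classical in
/-- The vertices which complete `G` to a facet. -/
noncomputable def coFacets (Δ : AbstractSimplicialComplex V) (G : Finset V) : Finset V :=
  Finset.univ.filter fun x => x ∉ G ∧ insert x G ∈ Δ.facets

theorem mem_coFacets {G : Finset V} {x : V} :
    x ∈ Δ.coFacets G ↔ x ∉ G ∧ insert x G ∈ Δ.facets := by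
  simp [coFacets]

theorem card_coFacets (hd : 1 ≤ d) (hpure : Δ.IsPureOfCard d) {G : Finset V}
    (hG : G.card = d - 1) : (Δ.coFacets G).card = Δ.facetDegree G := by
  rw [facetDegree, ← Finset.card_image_of_injOn (f := fun x => insert x G),
    ← Set.ncard_coe_finset]
  · congr 1
    ext F
    simp only [Finset.coe_image, Set.mem_image, SetLike.mem_coe, mem_coFacets, Set.mem_ofPred_eq]
    constructor
    · rintro ⟨x, ⟨-, hx⟩, rfl⟩
      exact ⟨hx, Finset.subset_insert _ _⟩
    · rintro ⟨hF, hGF⟩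
      obtain ⟨x, hx, rfl⟩ := (Finset.covBy_iff_exists_insert.1 (Finset.covBy_iff_card_sdiff_eq_one.2
        ⟨hGF, by rw [Finset.card_sdiff_of_subset hGF, hpure F hF, hG]; omega⟩))
      exact ⟨x, ⟨hx, hF⟩, rfl⟩
  · intro x hx y hy hxy
    have hx' := (mem_coFacets.1 hx).1
    have h : x ∈ insert y G := by
      rw [← show insert x G = insert y G from hxy]
      exact Finset.mem_insert_self x G
    exact (Finset.mem_insert.1 h).resolve_right hx'

variable {k : Type*} [Field k]

theorem betti_zero_eq (hpure : Δ.IsPureOfCard d)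
    (P : MinimalGradedFreeResolution (Δ.facetIdeal k)) : P.betti 0 d = Δ.facets.ncard := by
  classical
  have : Fintype Δ.facets := Fintype.ofFinite _
  rw [← Nat.card_coe_set_eq, Nat.card_eq_fintype_card]
  conv_lhs => rw [← zero_add d]
  refine P.betti_eq_card (le_degree_of_mem_facetIdeal hpure) 0
    (LinearMap.pi fun F : Δ.facets => lcoeff k (expo F.1) ∘ₗ LinearMap.proj Fin.elim0) ?_ ?_
  · intro z hz h
    ext1 α
    by_contra hne
    obtain ⟨m, hm⟩ := support_nonempty.2 hne
    obtain ⟨F, hF, rfl⟩ := exists_facet_of_mem_support hpure (hz.mem α).1 hm ((hz.mem α).2 m hm)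
    rw [Subsingleton.elim α Fin.elim0] at hm
    exact mem_support_iff.1 hm (congrFun h ⟨F, hF⟩)
  · intro F
    refine ⟨fun _ => monomial (expo F.1) 1, ⟨monomial_expo_mem_facetIdeal F.2, fun m hm => ?_⟩, ?_⟩
    · rw [Finset.mem_singleton.1 (support_monomial_subset hm), degree_expo, hpure _ F.2]
    · ext1 F'
      change coeff (expo F'.1) (monomial (expo F.1) 1) = _
      rw [coeff_monomial, Pi.single_apply]
      simp only [expo_injective.eq_iff, Subtype.ext_iff, eq_comm]

/-- In a forest, `G` is determined by a facet `G ∪ s` and a further facet `G ∪ a`. -/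
theorem eq_of_insert_eq_insert (hd : 2 ≤ d) (hpure : Δ.IsPureOfCard d) (hforest : Δ.IsForest)
    {G G' : Finset V} {a s s' : V} (hs : s ∈ Δ.coFacets G) (hs' : s' ∈ Δ.coFacets G')
    (ha : a ∈ Δ.coFacets G) (ha' : a ∈ Δ.coFacets G') (has : a ≠ s)
    (h : insert s G = insert s' G') : s = s' ∧ G = G' := by
  rw [mem_coFacets] at hs hs' ha ha'
  have h1 : (insert s G).erase s = G := Finset.erase_insert hs.1
  have h2 : (insert s G).erase s' = G' := by rw [h, Finset.erase_insert hs'.1]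
  have heq : s = s' := by
    refine FacetFamily.IsForest.erase_unique hforest hd hpure hs.2 (a := a) ?_
      (Finset.mem_insert_self _ _) (h ▸ Finset.mem_insert_self _ _) ?_ ?_
    · rw [Finset.mem_insert, not_or]
      exact ⟨has, ha.1⟩
    · rw [h1]; exact ha.2
    · rw [h2]; exact ha'.2
  refine ⟨heq, ?_⟩
  rw [← h1, ← h2, heq]

/-- The linear strand beyond its start. Coordinates on the Koszul cycles are indexed by the pairs of
a face `G` with `d - 1` vertices and a set `S` of `n + 2` vertices each of which completes `G` to a
facet: the coordinate of `z` is the coefficient of `x^G x_s` in `z(S ∖ s)`, where `s` is the last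
element of `S` in some enumeration. The dual basis consists of determinants. -/
theorem betti_succ_eq (hd : 2 ≤ d) (hpure : Δ.IsPureOfCard d) (hforest : Δ.IsForest)
    (P : MinimalGradedFreeResolution (Δ.facetIdeal k)) (n : ℕ) :
    P.betti (n + 1) (n + 1 + d) =
      ∑ G ∈ Δ.facesOfCard (d - 1), (Δ.facetDegree G).choose (n + 2) := by
  classical
  let B := (G : {G // G ∈ Δ.facesOfCard (d - 1)}) ×
    {S // S ∈ Finset.powersetCard (n + 2) (Δ.coFacets G.1)}
  have hcardG : ∀ b : B, b.1.1.card = d - 1 := fun b =>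
    (mem_facesOfCard.1 b.1.2).2
  have hcardB : Fintype.card B =
      ∑ G ∈ Δ.facesOfCard (d - 1), (Δ.facetDegree G).choose (n + 2) := by
    rw [Fintype.card_sigma,
      ← Finset.sum_coe_sort _ fun G => (Δ.facetDegree G).choose (n + 2)]
    refine Finset.sum_congr rfl fun G _ => ?_
    rw [Fintype.card_coe, Finset.card_powersetCard,
      card_coFacets (by omega) hpure (mem_facesOfCard.1 G.2).2]
  rw [← hcardB]
  have hS : ∀ b : B, b.2.1 ⊆ Δ.coFacets b.1.1 ∧ b.2.1.card = n + 2 := fun b =>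
    Finset.mem_powersetCard.1 b.2.2
  let e : B → Fin (n + 2) → V := fun b j => ((b.2.1.equivFinOfCardEq (hS b).2).symm j).1
  have he_inj : ∀ b, Function.Injective (e b) := fun b =>
    Subtype.val_injective.comp (Equiv.injective _)
  have he_range : ∀ b, Set.range (e b) = b.2.1 := fun b => by
    change Set.range (Subtype.val ∘ _) = _
    rw [EquivLike.range_comp]
    simp
  have he_mem : ∀ b j, e b j ∈ b.2.1 := fun b j => Subtype.coe_prop _
  have he_link : ∀ b j, e b j ∈ Δ.coFacets b.1.1 := fun b j => (hS b).1 (he_mem b j)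
  refine P.betti_eq_card (le_degree_of_mem_facetIdeal hpure) (n + 1)
    (LinearMap.pi fun b : B => lcoeff k (expo (insert (e b (Fin.last _)) b.1.1)) ∘ₗ
      LinearMap.proj (Fin.init (e b))) ?_ ?_
  · intro z hz h
    ext1 α
    by_contra hne
    obtain ⟨m, hm⟩ := support_nonempty.2 hne
    obtain ⟨F, hF, rfl⟩ := exists_facet_of_mem_support hpure (hz.mem α).1 hm ((hz.mem α).2 m hm)
    have hc := mem_support_iff.1 hm
    obtain ⟨b, hb, hbj⟩ := hz.exists_common_exchange hd hpure hforest (Nat.succ_pos n) hc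
    have hαF : ∀ j, α j ∉ F := fun j => (hz.exists_exchange hpure hc j).1
    have hα := hz.injective_of_coeff_ne_zero hpure hc
    -- the sequence `(α, b)`, all of whose members complete `G = F ∖ b` to a facet
    let γ : Fin (n + 2) → V := Fin.snoc α b
    have hγ : Function.Injective γ := by
      rw [Fin.snoc_injective_iff]
      exact ⟨hα, by rintro ⟨j, rfl⟩; exact hαF j hb⟩
    have hγG : ∀ j, γ j ∉ F.erase b ∧ insert (γ j) (F.erase b) ∈ Δ.facets := by
      intro j
      refine Fin.lastCases ?_ (fun j => ?_) j
      · simp only [γ, Fin.snoc_last]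
        rw [Finset.insert_erase hb]
        exact ⟨Finset.notMem_erase _ _, hF⟩
      · simp only [γ, Fin.snoc_castSucc]
        exact ⟨fun h => hαF j (Finset.mem_of_mem_erase h), hbj j⟩
    have hcG : (F.erase b).card = d - 1 := by rw [Finset.card_erase_of_mem hb, hpure F hF]
    let x : B := ⟨⟨F.erase b, by
      refine mem_facesOfCard.2 ⟨?_, hcG⟩
      exact (Δ.isRelLowerSet_faces hF.1).2 (Finset.erase_subset _ _)
        (Finset.card_pos.1 (by omega))⟩, ⟨Finset.univ.image γ, by
      rw [Finset.mem_powersetCard, Finset.card_image_of_injective _ hγ, Finset.card_fin]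
      refine ⟨fun y hy => ?_, rfl⟩
      obtain ⟨j, -, rfl⟩ := Finset.mem_image.1 hy
      exact mem_coFacets.2 (hγG j)⟩⟩
    have hrange : Set.range (e x) = Set.range γ := by
      rw [he_range]
      simp [x]
    let σ : Equiv.Perm (Fin (n + 2)) := (Equiv.ofInjective (e x) (he_inj x)).trans
      ((Equiv.setCongr hrange).trans (Equiv.ofInjective γ hγ).symm)
    have hσ : γ ∘ σ = e x := by
      ext1 j
      simp only [σ, Function.comp_apply, Equiv.trans_apply]
      exact Equiv.apply_ofInjective_symm hγ _
    have hfin := hz.coeff_perm_ne_zero hd hpure hforest hγG (by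
      simp only [γ, Fin.snoc_last, Fin.init_snoc]
      rwa [Finset.insert_erase hb]) σ
    rw [hσ] at hfin
    exact hfin (congrFun h x)
  · intro b
    let M : (Fin (n + 2) → V) → Matrix (Fin (n + 2)) (Fin (n + 2)) k :=
      fun γ => Matrix.of fun i j => if γ i = e b j then 1 else 0
    have hinj : ∀ γ, (M γ).det ≠ 0 → Function.Injective γ := by
      intro γ h i j hij
      by_contra hne
      refine h (Matrix.det_zero_of_row_eq hne ?_)
      ext1 l
      simp only [M, Matrix.of_apply, hij]
    have hmem : ∀ γ, (M γ).det ≠ 0 → ∀ i, γ i ∈ b.2.1 := by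
      intro γ h i
      by_contra hi
      refine h (Matrix.det_eq_zero_of_row_eq_zero i fun j => if_neg ?_)
      intro h'
      exact hi (h' ▸ he_mem b j)
    have hdet : (M (e b)).det = 1 := by
      have : M (e b) = 1 := by
        ext i j
        simp only [M, Matrix.of_apply, Matrix.one_apply, (he_inj b).eq_iff]
      rw [this, Matrix.det_one]
    have hstrand := isStrand_of_alternating (I := Δ.facetIdeal k) (G := b.1.1)
      (fun γ => (M γ).det) (fun γ hγ => by by_contra h; exact hγ (hinj γ h))
      (fun γ i j hij => by
        have := Matrix.det_permute (Equiv.swap i j) (M γ)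
        rw [Equiv.Perm.sign_swap hij] at this
        exact this.trans (by simp))
      (fun γ hγ => by
        have h := mem_coFacets.1 ((hS b).1 (hmem γ hγ (Fin.last _)))
        have h2 := monomial_expo_mem_facetIdeal (k := k) h.2
        rw [expo_insert h.1] at h2
        rwa [X, monomial_mul, one_mul])
    rw [hcardG b, show d - 1 + 1 = d by omega] at hstrand
    refine ⟨_, hstrand, ?_⟩
    ext1 b'
    change coeff (expo (insert (e b' (Fin.last _)) b'.1.1))
      (∑ s, C (M (Fin.snoc (Fin.init (e b')) s)).det * (monomial (expo b.1.1) 1 * X s)) = _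
    -- the coefficient of `x^{G'} x_{s'}`, where `s'` is the last element of `S'`
    have hterm : ∀ s, coeff (expo (insert (e b' (Fin.last _)) b'.1.1))
        (C (M (Fin.snoc (Fin.init (e b')) s)).det * (monomial (expo b.1.1) 1 * X s)) ≠ 0 →
        b' = b ∧ s = e b' (Fin.last _) := by
      intro s h
      rw [coeff_C_mul] at h
      have hD := left_ne_zero_of_mul h
      have hE := right_ne_zero_of_mul h
      have hγmem := hmem _ hD
      have hsS : s ∈ b.2.1 := by simpa using hγmem (Fin.last _)
      have hs := (hS b).1 hsS
      rw [X, monomial_mul, coeff_monomial, ← expo_insert (mem_coFacets.1 hs).1] at hE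
      have hE' := expo_injective (by_contra fun h => hE (if_neg h))
      have h0 : e b' 0 ∈ b.2.1 := by
        have := hγmem (Fin.castSucc 0)
        rw [Fin.snoc_castSucc] at this
        exact this
      have h0s : e b' 0 ≠ s := by
        have := (hinj _ hD).ne (Fin.castSucc_lt_last (0 : Fin (n + 1))).ne
        rw [Fin.snoc_castSucc, Fin.snoc_last] at this
        exact this
      obtain ⟨h1, h2⟩ := eq_of_insert_eq_insert hd hpure hforest hs (he_link b' _)
        ((hS b).1 h0) (he_link b' 0) h0s hE'
      have h3 : b'.2.1 = b.2.1 := by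
        refine Finset.eq_of_subset_of_card_le (fun y hy => ?_) (by rw [(hS b).2, (hS b').2])
        have hy' : y ∈ Set.range (e b') := by rw [he_range]; exact hy
        obtain ⟨j, rfl⟩ := hy'
        have := hγmem j
        rwa [h1, Fin.snoc_init_self] at this
      refine ⟨?_, h1⟩
      obtain ⟨⟨G, hG⟩, ⟨S, hS⟩⟩ := b
      obtain ⟨⟨G', hG'⟩, ⟨S', hS'⟩⟩ := b'
      obtain rfl : G = G' := h2
      obtain rfl : S' = S := h3
      rfl
    rw [coeff_sum, Pi.single_apply]
    split_ifs with hbb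
    · subst hbb
      rw [Finset.sum_eq_single_of_mem (e b' (Fin.last _)) (Finset.mem_univ _) fun s _ hs =>
        by_contra fun h => hs (hterm s h).2]
      rw [Fin.snoc_init_self, hdet, C_1, one_mul, X, monomial_mul,
        ← expo_insert (mem_coFacets.1 (he_link b' _)).1, coeff_monomial, if_pos rfl, one_mul]
    · exact Finset.sum_eq_zero fun s _ => by_contra fun h => hbb (hterm s h).1

end AbstractSimplicialComplex

/-- The linear strand of the facet ideal of a pure `(d - 1)`-dimensional simplicial forest. Graded
Betti numbers are those of an arbitrary minimal graded free resolution; that one exists is part of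
the claim. -/
theorem theorem5p9 {V : Type*} [Fintype V] [DecidableEq V] (k : Type*) [Field k]
    (Δ : AbstractSimplicialComplex V) (d : ℕ) (hd : 2 ≤ d)
    (hpure : Δ.IsPureOfCard d) (hforest : Δ.IsForest) :
    Nonempty (MinimalGradedFreeResolution (Δ.facetIdeal k)) ∧
    ∀ P : MinimalGradedFreeResolution (Δ.facetIdeal k),
      P.betti 0 d = Δ.facets.ncard ∧
      ∀ i : ℕ, 1 ≤ i →
        P.betti i (i + d) =
          ∑ G ∈ Δ.facesOfCard (d - 1), (Δ.facetDegree G).choose (i + 1) := by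
  refine ⟨nonempty_minimalGradedFreeResolution _
    AbstractSimplicialComplex.shiftPart_mem_facetIdeal, fun P =>
    ⟨AbstractSimplicialComplex.betti_zero_eq hpure P, fun i hi => ?_⟩⟩
  obtain ⟨n, rfl⟩ := Nat.exists_eq_add_of_le' hi
  exact AbstractSimplicialComplex.betti_succ_eq hd hpure hforest P n
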